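/- **Setting.** Let $d\ge 1$, let $\|\cdot\|$ be any norm on $\mathbb R^d$ and $B_r=\{x:\|x\|\le r\}$. Let $X\subset\mathbb R^d$ (with its Borel $\sigma$-algebra), let $\mathcal C(X)$ be a linear space of bounded measurable functions $g:X\to\mathbb R$ with a semi-norm $|||\cdot|||$, and put $\|g\|_{\mathcal C}=\|g\|_\infty+|||g|||$. Assume that $|||g|||=0$ for every constant $g\in\mathcal C(X)$, and that for every $g\in\mathcal C(X)$ one has $e^g\in\mathcal C(X)$ and $|||e^g|||\le\|e^g\|_\infty\,|||g|||$. Let $(X_i)_{i\ge1}$ be a stationary $X$-valued process on a probability space $(\Omega,\mathcal A,\mu)$. For $\psi,\varphi$ on $\Omega$ put $\mathrm{cor}(\psi,\varphi)=\int\psi\varphi\,d\mu-\int\psi\,d\mu\int\varphi\,d\mu$, and let $\mathcal A_i^j=\sigma(X_i,\dots,X_j)$. Define $$\phi(n)=\sup\{\mathrm{cor}(\psi,g(X_{k+n})): k\ge1,\ \|\psi\|_{L_1(\mathcal A_1^k,\mu)}\le1,\ \|g\|_{\mathcal C}\le1\},$$ $$\phi_{\mathrm{rev}}(n)=\sup\{\mathrm{cor}(g(X_k),\psi):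 k\ge1,\ \|g\|_{\mathcal C}\le1,\ \|\psi\|_{L_1(\mathcal A_{k+n}^\infty,\mu)}\le1\}.$$ Assume the process is geometrically $\mathcal C$-mixing or geometrically time-reversed $\mathcal C$-mixing: there are $c_0,b,\gamma>0$ such that $\phi(n)\le c_0e^{-bn^\gamma}$ for all $n\ge1$, or $\phi_{\mathrm{rev}}(n)\le c_0e^{-bn^\gamma}$ for all $n\ge1$. Let $K:[0,\infty)\to[0,\infty)$ be bounded and decreasing with $\int_{\mathbb R^d}K(\|x\|)\,dx=1$, and assume, for some $\beta\in[0,1]$: (i) $K$ is $\beta$-Hölder continuous; (ii) $\int_0^\infty K(r)r^{\beta+d-1}\,dr<\infty$; (iii) for all $x\in\mathbb R^d$ and $h>0$ one has $K(\|x-\cdot\|/h)\in\mathcal C(X)$ and $|||K(\|x-\cdot\|/h)|||\le\varphi(h)$, where $\varphi:(0,\infty)\to(0,\infty)$. For $h>0$ let $$f_{D,h}(x)=\frac1{nh^d}\sum_{i=1}^nK\Big(\frac{\|x-X_i\|}{h}\Big),\qquad x\in\mathbb R^d.$$ **Theorem.** Suppose that the law $P$ of $X_1$ satisfies $P(\mathbb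 R^d\setminus B_{r_0})=0$ for some $r_0\ge1$ (for instance, $X\subset B_{r_0}$), and that $P$ has a bounded Lebesgue density $f:\mathbb R^d\to[0,\infty)$ which is $\alpha$-Hölder continuous on $\mathbb R^d$ with $0<\alpha\le\beta$. Put $$h_n=\Big(\frac{(\log n)^{(2+\gamma)/\gamma}}{n}\Big)^{\frac1{2\alpha+d}},$$ $$n_0^*(h)=\max\Big\{\min\Big\{m\in\mathbb N: m\ge3,\ m\ge\Big(\frac{808\,c_0\,(3h^{-d}\varphi(h)+K(0))}{2K(0)}\Big)^{\frac1{d+1}},\ \frac{m}{(\log m)^{2/\gamma}}\ge4\Big\},\ e^{(d+1)/b}\Big\}.$$ Then there is a constant $c>0$, independent of $n$, such that for every $n\in\mathbb N$ with $n\ge n_0^*(h_n)$, with $\mu$-probability at least $1-\frac1n$, $$\sup_{x\in\mathbb R^d}|f_{D,h_n}(x)-f(x)|\le c\Big(\frac{(\log n)^{(2+\gamma)/\gamma}}{n}\Big)^{\frac{\alpha}{2\alpha+d}}.$$ -/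

import Mathlib

open MeasureTheory Set
open scoped ENNReal

noncomputable section

namespace CMixingKDE

/-- The supremum norm `‖g‖_∞ = sup_x |g x|`, with value `∞` for unbounded `g`. -/
def supNorm {Y : Type*} (g : Y → ℝ) : ℝ≥0∞ := ⨆ y, ENNReal.ofReal |g y|

section Mixing

variable {d : ℕ} {S : Set (Fin d → ℝ)} {Ω : Type*} [MeasurableSpace Ω]

/-- The correlation `∫ ψ φ dμ - ∫ ψ dμ ∫ φ dμ`. -/
def cor (μ : Measure Ω) (ψ φ : Ω → ℝ) : ℝ :=
  ∫ ω, ψ ω * φ ω ∂μ - (∫ ω, ψ ω ∂μ) * ∫ ω, φ ω ∂μ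

/-- The σ-algebra generated by the variables `X i`, `i ∈ I`. -/
abbrev processSigma (X : ℕ → Ω → S) (I : Set ℕ) : MeasurableSpace Ω :=
  ⨆ i ∈ I, MeasurableSpace.comap (X i) inferInstance

/-- `ψ` belongs to the closed unit ball of `L₁(m, μ)`, for a sub-σ-algebra `m`. -/
def InL1Ball (μ : Measure Ω) (m : MeasurableSpace Ω) (ψ : Ω → ℝ) : Prop :=
  Measurable[m] ψ ∧ Integrable ψ μ ∧ ∫ ω, |ψ ω| ∂μ ≤ 1

/-- `C` is a space of bounded measurable functions on `S`. -/
def IsBoundedMeasurableClass (C : Submodule ℝ (S → ℝ)) : Prop :=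
  ∀ g ∈ C, Measurable g ∧ ∃ B : ℝ, ∀ y, |g y| ≤ B

/-- The norm `‖g‖_C = ‖g‖_∞ + p g` on the function class `C` with semi-norm `p`. -/
def classNorm (C : Submodule ℝ (S → ℝ)) (p : Seminorm ℝ C) (g : C) : ℝ≥0∞ :=
  supNorm (g : S → ℝ) + ENNReal.ofReal (p g)

/-- The two requirements on the semi-norm: it vanishes on the constants of `C`, and `C` is stable
under `g ↦ e^g` with `p (e^g) ≤ ‖e^g‖_∞ p g`. -/
structure SeminormAssumption (C : Submodule ℝ (S → ℝ)) (p : Seminorm ℝ C) : Prop where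
  const : ∀ g : C, (∃ a : ℝ, ∀ y, (g : S → ℝ) y = a) → p g = 0
  exp : ∀ g : C, ∃ hg : (fun y => Real.exp ((g : S → ℝ) y)) ∈ C,
    ENNReal.ofReal (p ⟨fun y => Real.exp ((g : S → ℝ) y), hg⟩) ≤
      supNorm (fun y => Real.exp ((g : S → ℝ) y)) * ENNReal.ofReal (p g)

/-- Strict stationarity of `(X i)_{i ≥ 1}`; the variable `X 0` plays no role anywhere. -/
def IsStationary (μ : Measure Ω) (X : ℕ → Ω → S) : Prop :=
  ∀ (m j : ℕ) (i : Fin m → ℕ), (∀ l, 1 ≤ i l) →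
    μ.map (fun ω l => X (i l + j) ω) = μ.map (fun ω l => X (i l) ω)

/-- The `C`-mixing coefficient
`sup {cor(ψ, g(X_{k+n})) : k ≥ 1, ψ ∈ B_{L₁(A_1^k, μ)}, g ∈ B_C}`. -/
def mixingCoeff (μ : Measure Ω) (X : ℕ → Ω → S) (C : Submodule ℝ (S → ℝ)) (p : Seminorm ℝ C)
    (n : ℕ) : EReal :=
  sSup {r : EReal | ∃ (k : ℕ) (ψ : Ω → ℝ) (g : C), 1 ≤ k ∧
    InL1Ball μ (processSigma X (Icc 1 k)) ψ ∧ classNorm C p g ≤ 1 ∧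
    r = (cor μ ψ (fun ω => (g : S → ℝ) (X (k + n) ω)) : ℝ)}

/-- The time-reversed `C`-mixing coefficient
`sup {cor(g(X_k), ψ) : k ≥ 1, g ∈ B_C, ψ ∈ B_{L₁(A_{k+n}^∞, μ)}}`. -/
def mixingCoeffRev (μ : Measure Ω) (X : ℕ → Ω → S) (C : Submodule ℝ (S → ℝ)) (p : Seminorm ℝ C)
    (n : ℕ) : EReal :=
  sSup {r : EReal | ∃ (k : ℕ) (ψ : Ω → ℝ) (g : C), 1 ≤ k ∧
    InL1Ball μ (processSigma X (Ici (k + n))) ψ ∧ classNorm C p g ≤ 1 ∧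
    r = (cor μ (fun ω => (g : S → ℝ) (X k ω)) ψ : ℝ)}

/-- Geometrically `C`-mixing, or geometrically time-reversed `C`-mixing, with rate
`c₀ exp (-b n^γ)`. -/
def IsGeomMixing (μ : Measure Ω) (X : ℕ → Ω → S) (C : Submodule ℝ (S → ℝ)) (p : Seminorm ℝ C)
    (c₀ b γ : ℝ) : Prop :=
  (∀ n : ℕ, 1 ≤ n → mixingCoeff μ X C p n ≤ ((c₀ * Real.exp (-b * (n : ℝ) ^ γ) : ℝ) : EReal)) ∨
  (∀ n : ℕ, 1 ≤ n → mixingCoeffRev μ X C p n ≤ ((c₀ * Real.exp (-b * (n : ℝ) ^ γ) : ℝ) : EReal))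

end Mixing

section Kernel

variable {d : ℕ}

/-- A `d`-dimensional smoothing kernel `K : [0,∞) → [0,∞)` for the norm `N` on `ℝ^d`, normalised to
`∫ K(N x) dx = 1`. Only the values of `K` on `[0,∞)` matter. -/
structure IsSmoothingKernel (N : Seminorm ℝ (Fin d → ℝ)) (K : ℝ → ℝ) : Prop where
  nonneg : ∀ r, 0 ≤ r → 0 ≤ K r
  bounded : ∃ M : ℝ, ∀ r, 0 ≤ r → K r ≤ M
  antitone : AntitoneOn K (Ici 0)
  integral_eq_one : ∫ x : Fin d → ℝ, K (N x) = 1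

/-- The regularity requirements on the kernel relative to the function class `C` on `S`:
Hölder continuity with exponent `β ∈ [0,1]`, the moment condition, and the bound
`sup_x p (K(N(x - ·)/h)) ≤ φ h`. -/
structure KernelAssumption {S : Set (Fin d → ℝ)} (N : Seminorm ℝ (Fin d → ℝ)) (K : ℝ → ℝ) (β : ℝ)
    (C : Submodule ℝ (S → ℝ)) (p : Seminorm ℝ C) (φ : ℝ → ℝ) : Prop where
  exponent : β ∈ Icc (0 : ℝ) 1
  holder : ∃ L : ℝ, ∀ r s, 0 ≤ r → 0 ≤ s → |K r - K s| ≤ L * |r - s| ^ β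
  moment : IntegrableOn (fun r => K r * r ^ (β + d - 1)) (Ioi 0)
  φ_pos : ∀ h, 0 < h → 0 < φ h
  seminorm_le : ∀ (x : Fin d → ℝ) (h : ℝ), 0 < h →
    ∃ hx : (fun y : S => K (N (x - y) / h)) ∈ C, p ⟨fun y : S => K (N (x - y) / h), hx⟩ ≤ φ h

/-- The kernel density estimator `f_{D,h}(x) = (n h^d)⁻¹ ∑_{i=1}^n K(N(x - X_i)/h)`. -/
def kde {S : Set (Fin d → ℝ)} {Ω : Type*} (N : Seminorm ℝ (Fin d → ℝ)) (K : ℝ → ℝ)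
    (X : ℕ → Ω → S) (n : ℕ) (h : ℝ) (ω : Ω) (x : Fin d → ℝ) : ℝ :=
  1 / (n * h ^ d) * ∑ i ∈ Finset.Icc 1 n, K (N (x - X i ω) / h)

/-- `(log n)^{(2+γ)/γ} / n`. -/
def logRate (γ : ℝ) (n : ℕ) : ℝ := Real.log n ^ ((2 + γ) / γ) / n

/-- The bandwidth `h_n = ((log n)^{(2+γ)/γ} / n)^{1/(2α+d)}`. -/
def bandwidth (d : ℕ) (α γ : ℝ) (n : ℕ) : ℝ := logRate γ n ^ (1 / (2 * α + d))

/-- The sample size threshold at bandwidth `h`,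
`max {min {m ≥ 3 : m ≥ (808 c₀ (3 h^{-d} φ(h) + K(0)) / (2 K(0)))^{1/(d+1)},
m / (log m)^{2/γ} ≥ 4}, e^{(d+1)/b}}`. -/
def threshold (d : ℕ) (K φ : ℝ → ℝ) (c₀ b γ h : ℝ) : ℝ :=
  max ((sInf {m : ℕ | 3 ≤ m ∧
      (808 * c₀ * (3 * (φ h / h ^ d) + K 0) / (2 * K 0)) ^ (1 / ((d : ℝ) + 1)) ≤ m ∧
      4 ≤ (m : ℝ) / Real.log m ^ (2 / γ)} : ℕ) : ℝ)
    (Real.exp (((d : ℝ) + 1) / b))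

end Kernel

end CMixingKDE

end

/-! The error splits into a bias, of order `h ^ α` by Hölder continuity of `f` and the kernel moment
(`abs_integral_kernel_mul_comp_sub_le`), and a stochastic term, the deviation of the estimator from
its mean.

For the stochastic term at one point, the sample is cut into `k ≈ (log n)^(2/γ)` arithmetic
progressions of step `k`. Since `C` is stable under `exp`, the mixing bound can be applied to `e^w`.
Its error is proportional to the `L₁` norm of the other factor, so the Laplace transform along a
progression is at most a power of `E e^w + error` (`integral_exp_sum_le`). Chernoff's bound and a
union over the progressions give a Bernstein type inequality (`measure_sum_ge_le`). The kernel is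
scaled to `w = ± h^α K(N(y - ·)/h) / K 0`. Then second moment and deviation are both of order
`h^(2α+d)`, and the bandwidth makes `n h^(2α+d) / k` at least a multiple of `log n`
(`measure_abs_kde_sub_ge_le`). Since `k^γ ≥ (log n)²`, the mixing error beats every power of `n`,
and the threshold bounds `φ h` by such a power (`mixing_error_le_one`).

Uniformity in `x` comes from a net of a ball slightly larger than the support. Its size is
polynomial in `1/h ≤ n`, hence affordable in the union bound, and Hölder continuity of `K` and `f`
covers the gaps. Far from the support `f` vanishes and the decay of `K` makes the estimator small
(`abs_kde_sub_density_le`). All this holds for large `n`; the finitely many other `n` are absorbed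
in the constant by a crude bound. -/

namespace CMixingKDE

/-! ### Laplace transforms along arithmetic progressions -/

section Mixing

variable {d : ℕ} {S : Set (Fin d → ℝ)} {Ω : Type*} [MeasurableSpace Ω]

lemma IsStationary.map_eq {μ : Measure Ω} {X : ℕ → Ω → S} (hX : ∀ i, 1 ≤ i → Measurable (X i))
    (h : IsStationary μ X) {i : ℕ} (hi : 1 ≤ i) : μ.map (X i) = μ.map (X 1) := by
  have h1 := h 1 (i - 1) (fun _ => 1) (fun _ => le_rfl)
  rw [Nat.add_sub_cancel' hi] at h1
  have h2 := congrArg (Measure.map (fun v : Fin 1 → S => v 0)) h1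
  rw [Measure.map_map (measurable_pi_apply 0) (measurable_pi_lambda _ fun _ => hX i hi),
    Measure.map_map (measurable_pi_apply 0) (measurable_pi_lambda _ fun _ => hX 1 le_rfl)] at h2
  exact h2

lemma IsStationary.integral_comp_eq {μ : Measure Ω} {X : ℕ → Ω → S}
    (hX : ∀ i, 1 ≤ i → Measurable (X i)) (h : IsStationary μ X) {i : ℕ} (hi : 1 ≤ i)
    {g : S → ℝ} (hg : Measurable g) : ∫ ω, g (X i ω) ∂μ = ∫ ω, g (X 1 ω) ∂μ := by
  rw [← integral_map (hX i hi).aemeasurable hg.aestronglyMeasurable, h.map_eq hX hi,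
    integral_map (hX 1 le_rfl).aemeasurable hg.aestronglyMeasurable]

lemma measurable_processSigma {Ω : Type*} (X : ℕ → Ω → S) {I : Set ℕ} {i : ℕ} (hi : i ∈ I) :
    Measurable[processSigma X I] (X i) :=
  (comap_measurable (X i)).mono (le_iSup₂_of_le i hi le_rfl) le_rfl

lemma cor_comm (μ : Measure Ω) (ψ G : Ω → ℝ) : cor μ ψ G = cor μ G ψ := by
  simp only [cor, mul_comm]

/-- Mixing coefficients only see unit balls; homogeneity removes the normalisation. The error is
then proportional to `∫ ψ`, which is what lets the later induction multiply. When `∫ ψ = 0` no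
normalisation exists, but `ψ` vanishes almost everywhere. -/
lemma integral_mul_le_of_cor_le {μ : Measure Ω} {ψ G : Ω → ℝ} {B r : ℝ}
    (hψ : ∀ ω, 0 ≤ ψ ω) (hψi : Integrable ψ μ) (hB : 0 < B)
    (h : 0 < ∫ ω, ψ ω ∂μ →
      cor μ (fun ω => (∫ ω, ψ ω ∂μ)⁻¹ * ψ ω) (fun ω => B⁻¹ * G ω) ≤ r) :
    ∫ ω, ψ ω * G ω ∂μ ≤ (∫ ω, ψ ω ∂μ) * (∫ ω, G ω ∂μ + B * r) := by
  rcases (integral_nonneg (μ := μ) (f := ψ) hψ).eq_or_lt with h0 | h0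
  · have h1 : ψ =ᵐ[μ] 0 := (integral_eq_zero_iff_of_nonneg hψ hψi).1 h0.symm
    have h2 : ∫ ω, ψ ω * G ω ∂μ = 0 := by
      apply integral_eq_zero_of_ae
      filter_upwards [h1] with ω hω
      simp [hω]
    have h3 : ∫ ω, ψ ω ∂μ = 0 := h0.symm
    rw [h2, h3, zero_mul]
  · have h0' : 0 < ∫ ω, ψ ω ∂μ := h0
    have h1 := h h0'
    set I := ∫ ω, ψ ω ∂μ with hI
    have e1 : ∀ ω, I⁻¹ * ψ ω * (B⁻¹ * G ω) = (I⁻¹ * B⁻¹) * (ψ ω * G ω) := fun ω => by ring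
    simp only [cor, e1, integral_const_mul, ← hI] at h1
    have h2 : I⁻¹ * B⁻¹ * ∫ ω, ψ ω * G ω ∂μ - I⁻¹ * I * (B⁻¹ * ∫ ω, G ω ∂μ) =
        (∫ ω, ψ ω * G ω ∂μ - I * ∫ ω, G ω ∂μ) / (I * B) := by
      field_simp
    rw [h2, div_le_iff₀ (by positivity)] at h1
    linarith

lemma classNorm_inv_smul_le_one {C : Submodule ℝ (S → ℝ)} {p : Seminorm ℝ C} {g : C} {A₁ A₂ : ℝ}
    (hA₁ : 0 < A₁) (h1 : ∀ y, |(g : S → ℝ) y| ≤ A₁) (h2 : p g ≤ A₂) :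
    classNorm C p ((A₁ + A₂)⁻¹ • g) ≤ 1 := by
  have hA₂ : 0 ≤ A₂ := (apply_nonneg p g).trans h2
  have hB : 0 < A₁ + A₂ := by positivity
  have e1 : supNorm (((A₁ + A₂)⁻¹ • g : C) : S → ℝ) ≤ ENNReal.ofReal ((A₁ + A₂)⁻¹ * A₁) := by
    refine iSup_le fun y => ENNReal.ofReal_le_ofReal ?_
    rw [Submodule.coe_smul, Pi.smul_apply, smul_eq_mul, abs_mul, abs_of_pos (inv_pos.2 hB)]
    exact mul_le_mul_of_nonneg_left (h1 y) (inv_pos.2 hB).le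
  have e2 : ENNReal.ofReal (p ((A₁ + A₂)⁻¹ • g)) ≤ ENNReal.ofReal ((A₁ + A₂)⁻¹ * A₂) := by
    refine ENNReal.ofReal_le_ofReal ?_
    rw [map_smul_eq_mul, Real.norm_of_nonneg (inv_pos.2 hB).le]
    exact mul_le_mul_of_nonneg_left h2 (inv_pos.2 hB).le
  refine (add_le_add e1 e2).trans ?_
  rw [← ENNReal.ofReal_add (by positivity) (by positivity), ← mul_add, inv_mul_cancel₀ hB.ne']
  simp

lemma inL1Ball_normalize {Ω : Type*} {m : MeasurableSpace Ω} [MeasurableSpace Ω] {μ : Measure Ω}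
    {ψ : Ω → ℝ}
    (hm : Measurable[m] ψ) (hψ : ∀ ω, 0 ≤ ψ ω) (hψi : Integrable ψ μ) (h0 : 0 < ∫ ω, ψ ω ∂μ) :
    InL1Ball μ m (fun ω => (∫ ω, ψ ω ∂μ)⁻¹ * ψ ω) := by
  refine ⟨(measurable_const_mul _).comp hm, hψi.const_mul _, ?_⟩
  have : ∀ ω, |(∫ ω, ψ ω ∂μ)⁻¹ * ψ ω| = (∫ ω, ψ ω ∂μ)⁻¹ * ψ ω := fun ω =>
    abs_of_nonneg (mul_nonneg (inv_pos.2 h0).le (hψ ω))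
  simp only [this, integral_const_mul]
  rw [inv_mul_cancel₀ h0.ne']

lemma integral_mul_le_of_mixingCoeff_le {μ : Measure Ω} {X : ℕ → Ω → S}
    {C : Submodule ℝ (S → ℝ)} {p : Seminorm ℝ C} {k : ℕ} {r : ℝ}
    (hmix : mixingCoeff μ X C p k ≤ (r : ℝ)) {j : ℕ} (hj : 1 ≤ j) {ψ : Ω → ℝ}
    (hm : Measurable[processSigma X (Icc 1 j)] ψ) (hψ : ∀ ω, 0 ≤ ψ ω) (hψi : Integrable ψ μ)
    {g : C} {A₁ A₂ : ℝ} (hA₁ : 0 < A₁) (h1 : ∀ y, |(g : S → ℝ) y| ≤ A₁) (h2 : p g ≤ A₂) :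
    ∫ ω, ψ ω * (g : S → ℝ) (X (j + k) ω) ∂μ ≤
      (∫ ω, ψ ω ∂μ) * (∫ ω, (g : S → ℝ) (X (j + k) ω) ∂μ + (A₁ + A₂) * r) := by
  have hA₂ : 0 ≤ A₂ := (apply_nonneg p g).trans h2
  refine integral_mul_le_of_cor_le hψ hψi (by positivity) fun h0 => ?_
  refine EReal.coe_le_coe_iff.1 (le_trans ?_ hmix)
  exact le_sSup ⟨j, _, (A₁ + A₂)⁻¹ • g, hj, inL1Ball_normalize hm hψ hψi h0,
    classNorm_inv_smul_le_one hA₁ h1 h2, rfl⟩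

lemma integral_mul_le_of_mixingCoeffRev_le {μ : Measure Ω} {X : ℕ → Ω → S}
    {C : Submodule ℝ (S → ℝ)} {p : Seminorm ℝ C} {k : ℕ} {r : ℝ}
    (hmix : mixingCoeffRev μ X C p k ≤ (r : ℝ)) {j : ℕ} (hj : 1 ≤ j) {ψ : Ω → ℝ}
    (hm : Measurable[processSigma X (Ici (j + k))] ψ) (hψ : ∀ ω, 0 ≤ ψ ω) (hψi : Integrable ψ μ)
    {g : C} {A₁ A₂ : ℝ} (hA₁ : 0 < A₁) (h1 : ∀ y, |(g : S → ℝ) y| ≤ A₁) (h2 : p g ≤ A₂) :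
    ∫ ω, ψ ω * (g : S → ℝ) (X j ω) ∂μ ≤
      (∫ ω, ψ ω ∂μ) * (∫ ω, (g : S → ℝ) (X j ω) ∂μ + (A₁ + A₂) * r) := by
  have hA₂ : 0 ≤ A₂ := (apply_nonneg p g).trans h2
  refine integral_mul_le_of_cor_le hψ hψi (by positivity) fun h0 => ?_
  rw [cor_comm]
  refine EReal.coe_le_coe_iff.1 (le_trans ?_ hmix)
  exact le_sSup ⟨j, _, (A₁ + A₂)⁻¹ • g, hj, inL1Ball_normalize hm hψ hψi h0,
    classNorm_inv_smul_le_one hA₁ h1 h2, rfl⟩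

lemma SeminormAssumption.exp_le {C : Submodule ℝ (S → ℝ)} {p : Seminorm ℝ C}
    (hp : SeminormAssumption C p) {w : C} {A : ℝ} (hw : ∀ y, |(w : S → ℝ) y| ≤ 1) (hA : p w ≤ A) :
    ∃ hg : (fun y => Real.exp ((w : S → ℝ) y)) ∈ C,
      p ⟨fun y => Real.exp ((w : S → ℝ) y), hg⟩ ≤ Real.exp 1 * A := by
  obtain ⟨hg, h⟩ := hp.exp w
  refine ⟨hg, ?_⟩
  have hA0 : 0 ≤ A := (apply_nonneg p w).trans hA
  have h1 : supNorm (fun y => Real.exp ((w : S → ℝ) y)) ≤ ENNReal.ofReal (Real.exp 1) := by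
    refine iSup_le fun y => ENNReal.ofReal_le_ofReal ?_
    rw [Real.abs_exp]
    exact Real.exp_le_exp.2 ((le_abs_self _).trans (hw y))
  have h2 := h.trans (mul_le_mul' h1 (ENNReal.ofReal_le_ofReal hA))
  rw [← ENNReal.ofReal_mul (Real.exp_pos 1).le] at h2
  exact (ENNReal.ofReal_le_ofReal_iff (by positivity)).1 h2

lemma integrable_exp_sum {μ : Measure Ω} [IsProbabilityMeasure μ] {X : ℕ → Ω → S}
    (hX : ∀ i, 1 ≤ i → Measurable (X i)) {w : S → ℝ} (hwm : Measurable w)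
    (hw : ∀ y, |w y| ≤ 1) {a : ℕ → ℕ} (ha : ∀ s, 1 ≤ a s) (l : ℕ) :
    Integrable (fun ω => Real.exp (∑ s ∈ Finset.range l, w (X (a s) ω))) μ := by
  refine Integrable.of_bound (C := Real.exp l) ?_ (Filter.Eventually.of_forall fun ω => ?_)
  · refine (Real.measurable_exp.comp ?_).aestronglyMeasurable
    exact Finset.measurable_fun_sum _ fun s _ => hwm.comp (hX _ (ha s))
  · rw [Real.norm_eq_abs, Real.abs_exp]
    refine Real.exp_le_exp.2 ?_
    calc ∑ s ∈ Finset.range l, w (X (a s) ω) ≤ ∑ s ∈ Finset.range l, (1 : ℝ) :=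
          Finset.sum_le_sum fun s _ => (le_abs_self _).trans (hw _)
      _ = l := by simp

lemma measurable_exp_sum_processSigma {Ω : Type*} (X : ℕ → Ω → S) {w : S → ℝ} (hwm : Measurable w)
    {a : ℕ → ℕ} {l : ℕ} {I : Set ℕ} (ha : ∀ s < l, a s ∈ I) :
    Measurable[processSigma X I] (fun ω => Real.exp (∑ s ∈ Finset.range l, w (X (a s) ω))) := by
  let _ : MeasurableSpace Ω := processSigma X I
  refine Real.measurable_exp.comp ?_
  exact Finset.measurable_fun_sum _ fun s hs =>
    hwm.comp (measurable_processSigma X (ha s (Finset.mem_range.1 hs)))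

/-- Bound for the Laplace transform of a sum along an arithmetic progression of step `k`. -/
lemma integral_exp_sum_le {μ : Measure Ω} [IsProbabilityMeasure μ] {X : ℕ → Ω → S}
    (hX : ∀ i, 1 ≤ i → Measurable (X i)) (hstat : IsStationary μ X)
    {C : Submodule ℝ (S → ℝ)} (hC : IsBoundedMeasurableClass C) {p : Seminorm ℝ C}
    (hp : SeminormAssumption C p) {k : ℕ} {r : ℝ} (hr : 0 ≤ r)
    (hmix : mixingCoeff μ X C p k ≤ (r : ℝ) ∨ mixingCoeffRev μ X C p k ≤ (r : ℝ))
    {w : C} {A : ℝ} (hw : ∀ y, |(w : S → ℝ) y| ≤ 1) (hA : p w ≤ A) (l : ℕ) :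
    ∀ i, 1 ≤ i → ∫ ω, Real.exp (∑ s ∈ Finset.range l, (w : S → ℝ) (X (i + k * s) ω)) ∂μ ≤
      (∫ ω, Real.exp ((w : S → ℝ) (X 1 ω)) ∂μ + (Real.exp 1 + Real.exp 1 * A) * r) ^ l := by
  have hwm := (hC w w.2).1
  obtain ⟨hg, hpg⟩ := hp.exp_le hw hA
  have hA0 : 0 ≤ A := (apply_nonneg p w).trans hA
  have hg1 : ∀ y, |Real.exp ((w : S → ℝ) y)| ≤ Real.exp 1 := fun y => by
    rw [Real.abs_exp]
    exact Real.exp_le_exp.2 ((le_abs_self _).trans (hw y))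
  have hF : 0 ≤ ∫ ω, Real.exp ((w : S → ℝ) (X 1 ω)) ∂μ + (Real.exp 1 + Real.exp 1 * A) * r := by
    have : 0 ≤ ∫ ω, Real.exp ((w : S → ℝ) (X 1 ω)) ∂μ := integral_nonneg fun ω => (Real.exp_pos _).le
    positivity
  have hst : ∀ j, 1 ≤ j → ∫ ω, Real.exp ((w : S → ℝ) (X j ω)) ∂μ =
      ∫ ω, Real.exp ((w : S → ℝ) (X 1 ω)) ∂μ := fun j hj =>
    hstat.integral_comp_eq hX hj (Real.measurable_exp.comp hwm)
  induction l with
  | zero => intro i _; simp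
  | succ l ih =>
    intro i hi
    -- The forward case needs a nonempty past, ending at index `i + k * (l - 1)`; a single variable
    -- is settled by stationarity.
    rcases l.eq_zero_or_pos with rfl | hl
    · simp only [zero_add, Finset.range_one, Finset.sum_singleton, mul_zero, add_zero, pow_one]
      rw [hst i hi]
      have : 0 ≤ (Real.exp 1 + Real.exp 1 * A) * r := by positivity
      linarith
    rcases hmix with hmix | hmix
    -- Forward mixing splits off the last variable from its past.
    · have h1 := integral_mul_le_of_mixingCoeff_le hmix (j := i + k * (l - 1)) (by omega)
        (measurable_exp_sum_processSigma X hwm (a := fun s => i + k * s) (l := l)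
          (fun s hs => ⟨by omega, by
            have := Nat.mul_le_mul_left k (Nat.le_sub_one_of_lt hs)
            show i + k * s ≤ _
            omega⟩))
        (fun ω => (Real.exp_pos _).le)
        (integrable_exp_sum hX hwm hw (a := fun s => i + k * s) (fun s => by omega) l)
        (g := ⟨_, hg⟩) (Real.exp_pos 1) hg1 hpg
      have e : i + k * (l - 1) + k = i + k * l := by
        obtain ⟨q, rfl⟩ := Nat.exists_eq_add_of_le' hl
        simp only [Nat.add_sub_cancel]; ring
      simp only [e] at h1
      rw [hst (i + k * l) (by omega)] at h1
      simp only [Finset.sum_range_succ, Real.exp_add]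
      refine h1.trans ?_
      rw [pow_succ]
      exact mul_le_mul_of_nonneg_right (ih i hi) hF
    -- Reversed mixing splits off the first variable; the rest starts at `i + k`, so the induction
    -- must range over all `i`.
    · have h1 := integral_mul_le_of_mixingCoeffRev_le hmix (j := i) hi
        (measurable_exp_sum_processSigma X hwm (a := fun s => i + k + k * s) (l := l)
          (fun s hs => by simp only [mem_Ici]; omega))
        (fun ω => (Real.exp_pos _).le)
        (integrable_exp_sum hX hwm hw (a := fun s => i + k + k * s) (fun s => by omega) l)
        (g := ⟨_, hg⟩) (Real.exp_pos 1) hg1 hpg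
      simp only at h1
      rw [hst i hi] at h1
      have e : ∀ s, i + k * (s + 1) = i + k + k * s := fun s => by ring
      simp only [Finset.sum_range_succ', Real.exp_add, e, mul_zero, add_zero]
      refine h1.trans ?_
      rw [pow_succ]
      exact mul_le_mul_of_nonneg_right (ih (i + k) (by omega)) hF

/-- Chernoff bound for a sum along an arithmetic progression of step `k`. -/
lemma measure_sum_progression_ge_le {μ : Measure Ω} [IsProbabilityMeasure μ] {X : ℕ → Ω → S}
    (hX : ∀ i, 1 ≤ i → Measurable (X i)) (hstat : IsStationary μ X)
    {C : Submodule ℝ (S → ℝ)} (hC : IsBoundedMeasurableClass C) {p : Seminorm ℝ C}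
    (hp : SeminormAssumption C p) {k : ℕ} {r : ℝ} (hr : 0 ≤ r)
    (hmix : mixingCoeff μ X C p k ≤ (r : ℝ) ∨ mixingCoeffRev μ X C p k ≤ (r : ℝ))
    {w : C} {A v δ : ℝ} (hw : ∀ y, |(w : S → ℝ) y| ≤ 1) (hA : p w ≤ A)
    (hv : ∫ ω, (w : S → ℝ) (X 1 ω) ^ 2 ∂μ ≤ v) {l : ℕ}
    (hl : l * (Real.exp 2 * (1 + A) * r) ≤ 1) {i : ℕ} (hi : 1 ≤ i) :
    μ.real {ω | l * (∫ ω, (w : S → ℝ) (X 1 ω) ∂μ + δ) ≤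
      ∑ s ∈ Finset.range l, (w : S → ℝ) (X (i + k * s) ω)} ≤ Real.exp (1 + l * v - l * δ) := by
  have hwm := (hC w w.2).1
  set m := ∫ ω, (w : S → ℝ) (X 1 ω) ∂μ with hm
  have hA0 : 0 ≤ A := (apply_nonneg p w).trans hA
  have hwi : Integrable (fun ω => (w : S → ℝ) (X 1 ω)) μ :=
    Integrable.of_bound (C := 1) (hwm.comp (hX 1 le_rfl)).aestronglyMeasurable
      (Filter.Eventually.of_forall fun ω => hw _)
  have hw2i : Integrable (fun ω => (w : S → ℝ) (X 1 ω) ^ 2) μ :=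
    Integrable.of_bound (C := 1) ((hwm.comp (hX 1 le_rfl)).pow_const 2).aestronglyMeasurable
      (Filter.Eventually.of_forall fun ω => by
        rw [Real.norm_eq_abs, abs_pow]; exact pow_le_one₀ (abs_nonneg _) (hw _))
  have hm1 : -1 ≤ m := by
    have : ∫ _ω, (-1 : ℝ) ∂μ ≤ m :=
      integral_mono (integrable_const _) hwi fun ω => (abs_le.1 (hw _)).1
    simpa using this
  have hv0 : 0 ≤ v := (integral_nonneg fun ω => sq_nonneg _).trans hv
  -- From `e^x ≤ 1 + x + x²` for `|x| ≤ 1`, followed by `1 + u ≤ e^u`.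
  have hE : ∫ ω, Real.exp ((w : S → ℝ) (X 1 ω)) ∂μ ≤ Real.exp (m + v) := by
    have h1 : ∫ ω, Real.exp ((w : S → ℝ) (X 1 ω)) ∂μ ≤
        ∫ ω, (1 + (w : S → ℝ) (X 1 ω) + (w : S → ℝ) (X 1 ω) ^ 2) ∂μ := by
      refine integral_mono ?_ (((integrable_const _).add hwi).add hw2i) fun ω => ?_
      · simpa using integrable_exp_sum hX hwm hw (a := fun _ => 1) (fun _ => le_rfl) 1
      · have := (abs_le.1 (Real.abs_exp_sub_one_sub_id_le (hw (X 1 ω)))).2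
        simp only
        linarith
    have h2 : ∫ ω, (1 + (w : S → ℝ) (X 1 ω) + (w : S → ℝ) (X 1 ω) ^ 2) ∂μ =
        1 + m + ∫ ω, (w : S → ℝ) (X 1 ω) ^ 2 ∂μ := by
      have h3 : Integrable (fun ω => 1 + (w : S → ℝ) (X 1 ω)) μ := (integrable_const _).add hwi
      rw [integral_add h3 hw2i, integral_add (integrable_const _) hwi]
      simp [hm]
    have h3 := Real.add_one_le_exp (m + v)
    linarith
  -- The additive mixing error becomes a factor close to one because `m + v ≥ -1`. By `hl`, the
  -- product of `l` such factors costs at most `e`.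
  have hη : Real.exp (m + v) + (Real.exp 1 + Real.exp 1 * A) * r ≤
      Real.exp (m + v) * Real.exp (Real.exp 2 * (1 + A) * r) := by
    have h1 : Real.exp 1 ≤ Real.exp (m + v) * Real.exp 2 := by
      rw [← Real.exp_add]; exact Real.exp_le_exp.2 (by linarith)
    have h2 := Real.add_one_le_exp (Real.exp 2 * (1 + A) * r)
    calc Real.exp (m + v) + (Real.exp 1 + Real.exp 1 * A) * r
        = Real.exp (m + v) + Real.exp 1 * ((1 + A) * r) := by ring
      _ ≤ Real.exp (m + v) + Real.exp (m + v) * Real.exp 2 * ((1 + A) * r) := by gcongr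
      _ = Real.exp (m + v) * (Real.exp 2 * (1 + A) * r + 1) := by ring
      _ ≤ _ := by gcongr
  have hlap := integral_exp_sum_le hX hstat hC hp hr hmix hw hA l i hi
  have hlap2 : ∫ ω, Real.exp (∑ s ∈ Finset.range l, (w : S → ℝ) (X (i + k * s) ω)) ∂μ ≤
      Real.exp (l * (m + v) + 1) := by
    refine hlap.trans ?_
    have h0 : 0 ≤ ∫ ω, Real.exp ((w : S → ℝ) (X 1 ω)) ∂μ :=
      integral_nonneg fun ω => (Real.exp_pos _).le
    have : (∫ ω, Real.exp ((w : S → ℝ) (X 1 ω)) ∂μ + (Real.exp 1 + Real.exp 1 * A) * r) ^ l ≤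
        (Real.exp (m + v) * Real.exp (Real.exp 2 * (1 + A) * r)) ^ l := by
      refine pow_le_pow_left₀ (by positivity) ?_ l
      linarith
    refine this.trans ?_
    rw [← Real.exp_add, ← Real.exp_nat_mul]
    refine Real.exp_le_exp.2 ?_
    rw [mul_add]
    linarith
  have hmk := mul_meas_ge_le_integral_of_nonneg (μ := μ)
    (Filter.Eventually.of_forall fun ω => (Real.exp_pos
      (∑ s ∈ Finset.range l, (w : S → ℝ) (X (i + k * s) ω))).le)
    (integrable_exp_sum hX hwm hw (a := fun s => i + k * s) (fun s => by omega) l)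
    (Real.exp (l * (m + δ)))
  simp only [Real.exp_le_exp] at hmk
  have h4 : Real.exp (l * (m + v) + 1) =
      Real.exp (l * (m + δ)) * Real.exp (1 + l * v - l * δ) := by
    rw [← Real.exp_add]; congr 1; ring
  rw [h4] at hlap2
  exact le_of_mul_le_mul_left (hmk.trans hlap2) (Real.exp_pos _)

end Mixing

/-! ### Arbitrary norms on `ℝ^d`: equivalence, polar coordinates, nets -/

section Norm

variable {d : ℕ}

lemma exists_le_mul_norm (N : Seminorm ℝ (Fin d → ℝ)) : ∃ a : ℝ, 0 ≤ a ∧ ∀ x, N x ≤ a * ‖x‖ := by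
  refine ⟨∑ i, N (Pi.single i 1), Finset.sum_nonneg fun i _ => apply_nonneg N _, fun x => ?_⟩
  have hx : x = ∑ i, x i • (Pi.single i 1 : Fin d → ℝ) := by
    ext j
    simp [Finset.sum_apply, Pi.single_apply]
  calc N x = N (∑ i, x i • (Pi.single i 1 : Fin d → ℝ)) := by rw [← hx]
    _ ≤ ∑ i, N (x i • (Pi.single i 1 : Fin d → ℝ)) := Finset.le_sum_of_subadditive N (map_zero N).le (map_add_le_add N) _ _
    _ ≤ ∑ i, N (Pi.single i 1) * ‖x‖ := Finset.sum_le_sum fun i _ => by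
        rw [map_smul_eq_mul, mul_comm]
        exact mul_le_mul_of_nonneg_left (norm_le_pi_norm x i) (apply_nonneg N _)
    _ = _ := by rw [Finset.sum_mul]

lemma continuous_seminorm (N : Seminorm ℝ (Fin d → ℝ)) : Continuous N := by
  obtain ⟨a, ha, h⟩ := exists_le_mul_norm N
  refine (LipschitzWith.of_dist_le_mul (K := a.toNNReal) fun x y => ?_).continuous
  rw [Real.dist_eq, Real.coe_toNNReal a ha, dist_eq_norm]
  exact (abs_sub_map_le_sub N x y).trans (h _)

lemma exists_norm_le_mul {N : Seminorm ℝ (Fin d → ℝ)} (hN : ∀ x, N x = 0 → x = 0) :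
    ∃ a : ℝ, 0 < a ∧ ∀ x, ‖x‖ ≤ a * N x := by
  by_cases hne : (Metric.sphere (0 : Fin d → ℝ) 1).Nonempty
  · obtain ⟨x₀, hx₀, hmin⟩ := (isCompact_sphere (0 : Fin d → ℝ) 1).exists_isMinOn hne
      (continuous_seminorm N).continuousOn
    have h0 : 0 < N x₀ := by
      refine (apply_nonneg N x₀).lt_of_ne fun h => ?_
      have := hN x₀ h.symm
      simp [this] at hx₀
    refine ⟨(N x₀)⁻¹, inv_pos.2 h0, fun x => ?_⟩
    rcases eq_or_ne x 0 with rfl | hx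
    · simp
    · have hx' : 0 < ‖x‖ := norm_pos_iff.2 hx
      have hm : N x₀ ≤ N (‖x‖⁻¹ • x) := hmin (by
        simp [norm_smul, hx'.ne'])
      rw [map_smul_eq_mul, norm_inv, norm_norm] at hm
      rw [inv_mul_eq_div, le_div_iff₀ h0]
      calc ‖x‖ * N x₀ ≤ ‖x‖ * (‖x‖⁻¹ * N x) := by gcongr
        _ = N x := by field_simp
  -- An empty unit sphere means that the space is trivial.
  · refine ⟨1, one_pos, fun x => ?_⟩
    rcases eq_or_ne x 0 with rfl | hx
    · simp
    · exact (hne ⟨‖x‖⁻¹ • x, by simp [norm_smul, (norm_pos_iff.2 hx).ne']⟩).elim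

lemma continuous_of_abs_sub_le_rpow {N : Seminorm ℝ (Fin d → ℝ)} {g : (Fin d → ℝ) → ℝ} {L β : ℝ}
    (hβ : 0 < β) (h : ∀ x y, |g x - g y| ≤ L * N (x - y) ^ β) : Continuous g := by
  refine continuous_iff_continuousAt.2 fun x₀ => ?_
  refine tendsto_iff_norm_sub_tendsto_zero.2 ?_
  refine squeeze_zero (fun _ => norm_nonneg _) (fun y => h y x₀) ?_
  have h1 : Continuous fun y => L * N (y - x₀) ^ β :=
    continuous_const.mul (((continuous_seminorm N).comp (continuous_id.sub continuous_const)).rpow_const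
      fun _ => Or.inr hβ.le)
  have := h1.tendsto x₀
  simpa [Real.zero_rpow hβ.ne'] using this

/-- The image of Lebesgue measure under a linear isomorphism is a Haar measure, so polar coordinates
in `F` can be pulled back. -/
lemma integrable_comp_iff_of_norm_eq (hd : 1 ≤ d) {N : (Fin d → ℝ) → ℝ} {F : Type*}
    [NormedAddCommGroup F] [NormedSpace ℝ F] [MeasurableSpace F] [BorelSpace F]
    (φ : (Fin d → ℝ) ≃ₗ[ℝ] F) (hφ : ∀ x, ‖φ x‖ = N x) {g : ℝ → ℝ} :
    Integrable (fun x => g (N x)) ↔ IntegrableOn (fun y : ℝ => y ^ (d - 1) • g y) (Ioi 0) := by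
  have : FiniteDimensional ℝ F := φ.finiteDimensional
  have : Nonempty (Fin d) := ⟨⟨0, hd⟩⟩
  have : Nontrivial F := φ.symm.toEquiv.nontrivial
  have hdim : Module.finrank ℝ F = d := by rw [← φ.finrank_eq, Module.finrank_fin_fun]
  let ψ := φ.toContinuousLinearEquiv
  have hν := ContinuousLinearEquiv.isAddHaarMeasure_map ψ (volume : Measure (Fin d → ℝ))
  have h1 := integrable_fun_norm_addHaar ((volume : Measure (Fin d → ℝ)).map ψ) (f := g)
  rw [hdim] at h1
  rw [← h1]
  have h2 := integrable_map_equiv ψ.toHomeomorph.toMeasurableEquiv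
    (μ := (volume : Measure (Fin d → ℝ))) (fun x : F => g ‖x‖)
  refine Iff.trans ?_ h2.symm
  have h3 : (fun x : F => g ‖x‖) ∘ ψ.toHomeomorph.toMeasurableEquiv = fun x => g (N x) :=
    funext fun x => congrArg g (hφ x)
  rw [h3]

/-- The space `ℝ^d`, to be equipped with the norm `N`. -/
def Renormed (_N : Seminorm ℝ (Fin d → ℝ)) : Type := Fin d → ℝ

instance (N : Seminorm ℝ (Fin d → ℝ)) : AddCommGroup (Renormed N) :=
  inferInstanceAs (AddCommGroup (Fin d → ℝ))

instance (N : Seminorm ℝ (Fin d → ℝ)) : Module ℝ (Renormed N) :=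
  inferInstanceAs (Module ℝ (Fin d → ℝ))

/-- Integrability in polar coordinates for an arbitrary norm on `ℝ^d`. -/
lemma integrable_comp_seminorm_iff (hd : 1 ≤ d) {N : Seminorm ℝ (Fin d → ℝ)}
    (hN : ∀ x, N x = 0 → x = 0) {g : ℝ → ℝ} :
    Integrable (fun x => g (N x)) ↔ IntegrableOn (fun y : ℝ => y ^ (d - 1) • g y) (Ioi 0) := by
  -- The type copy keeps the norm `N` from clashing with the sup norm on `Fin d → ℝ`.
  let q : AddGroupNorm (Renormed N) :=
    ⟨⟨N, map_zero N, map_add_le_add N, map_neg_eq_map N⟩, fun x hx => hN x hx⟩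
  let _ : NormedAddCommGroup (Renormed N) := q.toNormedAddCommGroup
  let _ : NormedSpace ℝ (Renormed N) := { norm_smul_le := fun r x => (map_smul_eq_mul N r x).le }
  let _ : MeasurableSpace (Renormed N) := borel (Renormed N)
  have : BorelSpace (Renormed N) := ⟨rfl⟩
  exact integrable_comp_iff_of_norm_eq hd (F := Renormed N)
    (LinearEquiv.refl ℝ (Fin d → ℝ)) (fun x => rfl)

/-- Finite nets of polynomial size for balls. -/
lemma exists_net {N : Seminorm ℝ (Fin d → ℝ)} (hN : ∀ x, N x = 0 → x = 0) {R : ℝ} (hR : 0 ≤ R) :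
    ∃ B : ℝ, 0 < B ∧ ∀ δ : ℝ, 0 < δ → δ ≤ 1 → ∃ T : Finset (Fin d → ℝ),
      (∀ x, N x ≤ R → ∃ y ∈ T, N (x - y) ≤ δ) ∧ (T.card : ℝ) ≤ (B / δ) ^ d := by
  obtain ⟨a₁, ha₁, h₁⟩ := exists_le_mul_norm N
  obtain ⟨a₂, ha₂, h₂⟩ := exists_norm_le_mul hN
  set a := a₁ + 1 with ha
  have ha1 : 1 ≤ a := by linarith
  have ha0 : 0 < a := by linarith
  -- The net is the grid of mesh `1 / m`, with numerators in `[-J, J]`. As `m ≤ 2a/δ`, each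
  -- coordinate takes `2J + 1 ≤ 2 a₂ R m + 5` values, at most `(4 a a₂ R + 5) / δ`.
  refine ⟨4 * a * a₂ * R + 7, by positivity, fun δ hδ hδ1 => ?_⟩
  set m := ⌈a / δ⌉₊ with hm
  have hmpos : 0 < a / δ := by positivity
  have hm1 : a / δ ≤ m := Nat.le_ceil _
  have hm0 : (0 : ℝ) < m := hmpos.trans_le hm1
  have hm2 : (m : ℝ) ≤ 2 * a / δ := by
    have := (Nat.ceil_lt_add_one hmpos.le).le
    have h3 : 1 ≤ a / δ := by rw [le_div_iff₀ hδ]; linarith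
    calc (m : ℝ) ≤ a / δ + 1 := this
      _ ≤ a / δ + a / δ := by linarith
      _ = 2 * a / δ := by ring
  set J := ⌈a₂ * R * m⌉₊ + 1 with hJ
  have hJ0 : a₂ * R * m + 1 ≤ J := by
    rw [hJ]; push_cast; linarith [Nat.le_ceil (a₂ * R * m)]
  have hJ1 : (J : ℝ) ≤ a₂ * R * m + 2 := by
    have := (Nat.ceil_lt_add_one (show 0 ≤ a₂ * R * m by positivity)).le
    rw [hJ]; push_cast; linarith
  refine ⟨(Fintype.piFinset fun _ : Fin d => Finset.Icc (-(J : ℤ)) J).image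
    (fun z i => (z i : ℝ) / m), fun x hx => ?_, ?_⟩
  · refine ⟨fun i => (⌊m * x i⌋ : ℝ) / m, ?_, ?_⟩
    · refine Finset.mem_image.2 ⟨fun i => ⌊m * x i⌋, ?_, rfl⟩
      refine Fintype.mem_piFinset.2 fun i => Finset.mem_Icc.2 ?_
      have hxi : |x i| ≤ a₂ * R := (norm_le_pi_norm x i).trans ((h₂ x).trans (by gcongr))
      have h5 : |m * x i| ≤ a₂ * R * m := by
        rw [abs_mul, abs_of_pos hm0, mul_comm]; gcongr
      have h6 := abs_le.1 h5
      constructor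
      · rw [Int.le_floor]; push_cast; linarith
      · have h7 : (⌊m * x i⌋ : ℝ) ≤ J := (Int.floor_le _).trans (by linarith)
        exact_mod_cast h7
    · have h3 : ‖x - fun i => (⌊m * x i⌋ : ℝ) / m‖ ≤ 1 / m := by
        refine (pi_norm_le_iff_of_nonneg (by positivity)).2 fun i => ?_
        have e : (x - fun i => (⌊m * x i⌋ : ℝ) / m) i = Int.fract (m * x i) / m := by
          simp only [Pi.sub_apply, Int.fract]; field_simp
        rw [e, Real.norm_eq_abs, abs_of_nonneg (div_nonneg (Int.fract_nonneg _) hm0.le)]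
        gcongr
        exact (Int.fract_lt_one _).le
      calc N (x - fun i => (⌊m * x i⌋ : ℝ) / m)
          ≤ a₁ * ‖x - fun i => (⌊m * x i⌋ : ℝ) / m‖ := h₁ _
        _ ≤ a * (1 / m) := by gcongr; linarith
        _ ≤ δ := by
          rw [mul_one_div, div_le_iff₀ hm0]
          rw [div_le_iff₀ hδ] at hm1
          linarith
  · have hc : ((Fintype.piFinset fun _ : Fin d => Finset.Icc (-(J : ℤ)) J).card : ℝ) =
        (2 * J + 1) ^ d := by
      rw [Fintype.card_piFinset]
      simp only [Int.card_Icc, Finset.prod_const, Finset.card_univ, Fintype.card_fin]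
      rw [show ((J : ℤ) + 1 - -(J : ℤ)).toNat = 2 * J + 1 by omega]
      push_cast; ring
    refine (Nat.cast_le.2 Finset.card_image_le).trans ?_
    rw [hc]
    refine pow_le_pow_left₀ (by positivity) ?_ d
    rw [le_div_iff₀ hδ]
    rw [le_div_iff₀ hδ] at hm2
    have h8 : a₂ * R * (m * δ) ≤ a₂ * R * (2 * a) := by gcongr
    nlinarith

end Norm

/-! ### Kernel moments, decay and bias -/

section Kernel

variable {d : ℕ} {N : Seminorm ℝ (Fin d → ℝ)} {K : ℝ → ℝ}

lemma IsSmoothingKernel.le_zero (hK : IsSmoothingKernel N K) {r : ℝ} (hr : 0 ≤ r) : K r ≤ K 0 :=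
  hK.antitone self_mem_Ici hr hr

lemma IsSmoothingKernel.zero_pos (hK : IsSmoothingKernel N K) : 0 < K 0 := by
  refine (hK.nonneg 0 le_rfl).lt_of_ne fun h => ?_
  have h1 : ∀ x : Fin d → ℝ, K (N x) = 0 := fun x =>
    le_antisymm ((hK.le_zero (apply_nonneg N x)).trans h.symm.le) (hK.nonneg _ (apply_nonneg N x))
  have := hK.integral_eq_one
  simp [h1] at this

/-- A non-integrable function has integral `0` by convention, so the value `1` forces integrability.
-/
lemma IsSmoothingKernel.integrable (hK : IsSmoothingKernel N K) :
    Integrable (fun x : Fin d → ℝ => K (N x)) := by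
  by_contra h
  have := hK.integral_eq_one
  rw [integral_undef h] at this
  exact zero_ne_one this

lemma abs_kernel_sub_le {L β : ℝ} (hL : 0 ≤ L) (hβ : 0 ≤ β)
    (h : ∀ r s, 0 ≤ r → 0 ≤ s → |K r - K s| ≤ L * |r - s| ^ β) (x y : Fin d → ℝ) :
    |K (N x) - K (N y)| ≤ L * N (x - y) ^ β := by
  refine (h _ _ (apply_nonneg N x) (apply_nonneg N y)).trans ?_
  have := abs_sub_map_le_sub N x y
  gcongr

/-- Polar coordinates turn the radial moment condition into the case `α = β`; smaller exponents
follow from `N x ^ α ≤ 1 + N x ^ β`. -/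
lemma integrable_kernel_mul_rpow (hd : 1 ≤ d) (hN : ∀ x, N x = 0 → x = 0)
    (hK : IsSmoothingKernel N K) {α β : ℝ} (hα : 0 < α) (hαβ : α ≤ β)
    (hm : IntegrableOn (fun r => K r * r ^ (β + d - 1)) (Ioi 0)) :
    Integrable (fun x : Fin d → ℝ => K (N x) * N x ^ α) := by
  have h1 : Integrable (fun x : Fin d → ℝ => K (N x) * N x ^ β) := by
    refine (integrable_comp_seminorm_iff hd hN (g := fun r => K r * r ^ β)).2 ?_
    refine hm.congr_fun (fun r hr => ?_) measurableSet_Ioi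
    have hr' : (0 : ℝ) < r := hr
    have e : β + d - 1 = β + ((d - 1 : ℕ) : ℝ) := by rw [Nat.cast_sub hd]; push_cast; ring
    simp only [smul_eq_mul]
    rw [e, Real.rpow_add hr', Real.rpow_natCast]
    ring
  refine (hK.integrable.add h1).mono' ?_ (Filter.Eventually.of_forall fun x => ?_)
  · exact hK.integrable.aestronglyMeasurable.mul
      ((continuous_seminorm N).rpow_const fun _ => Or.inr hα.le).aestronglyMeasurable
  · have hk := hK.nonneg _ (apply_nonneg N x)
    have hx := apply_nonneg N x
    rw [Real.norm_of_nonneg (mul_nonneg hk (Real.rpow_nonneg hx _))]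
    have h2 : N x ^ α ≤ 1 + N x ^ β := by
      rcases le_total (N x) 1 with h | h
      · linarith [Real.rpow_le_one hx h hα.le, Real.rpow_nonneg hx β]
      · linarith [Real.rpow_le_rpow_of_exponent_le h hαβ]
    calc K (N x) * N x ^ α ≤ K (N x) * (1 + N x ^ β) := by gcongr
      _ = _ := by simp only [Pi.add_apply]; ring

/-- Monotonicity turns the integral condition into pointwise decay: on `(r/2, r]`, of length `r/2`,
the integrand is at least `K r * (r/2) ^ (β + d - 1)`, the exponent being nonnegative. -/
lemma exists_kernel_mul_rpow_le (hd : 1 ≤ d) (hK : IsSmoothingKernel N K) {β : ℝ} (hβ : 0 ≤ β)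
    (hm : IntegrableOn (fun r => K r * r ^ (β + d - 1)) (Ioi 0)) :
    ∃ B : ℝ, 0 ≤ B ∧ ∀ r, 0 < r → K r * r ^ (β + d) ≤ B := by
  have hd' : (1 : ℝ) ≤ d := by exact_mod_cast hd
  have hnn : ∀ s ∈ Ioi (0 : ℝ), 0 ≤ K s * s ^ (β + d - 1) := fun s hs =>
    mul_nonneg (hK.nonneg s (le_of_lt hs)) (Real.rpow_nonneg (le_of_lt hs) _)
  refine ⟨2 ^ (β + d) * ∫ r in Ioi 0, K r * r ^ (β + d - 1),
    mul_nonneg (by positivity) (setIntegral_nonneg measurableSet_Ioi hnn), fun r hr => ?_⟩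
  have hsub : Ioc (r / 2) r ⊆ Ioi 0 := fun s hs => (half_pos hr).trans hs.1
  have h1 : ∫ s in Ioc (r / 2) r, K r * (r / 2) ^ (β + d - 1) ≤
      ∫ s in Ioc (r / 2) r, K s * s ^ (β + d - 1) := by
    refine setIntegral_mono_on (integrableOn_const (by simp)) (hm.mono_set hsub) measurableSet_Ioc
      fun s hs => ?_
    have hs0 : 0 < s := hsub hs
    have : K r ≤ K s := hK.antitone hs0.le hr.le hs.2
    have h3 : (r / 2) ^ (β + d - 1) ≤ s ^ (β + d - 1) :=
      Real.rpow_le_rpow (by positivity) hs.1.le (by linarith)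
    exact mul_le_mul this h3 (by positivity) (hK.nonneg s hs0.le)
  have h2 : ∫ s in Ioc (r / 2) r, K s * s ^ (β + d - 1) ≤
      ∫ s in Ioi 0, K s * s ^ (β + d - 1) :=
    setIntegral_mono_set hm ((ae_restrict_iff' measurableSet_Ioi).2
      (Filter.Eventually.of_forall hnn)) (Filter.Eventually.of_forall hsub)
  have h3 : ∫ s in Ioc (r / 2) r, K r * (r / 2) ^ (β + d - 1) = K r * (r / 2) ^ (β + d) := by
    rw [setIntegral_const, Real.volume_real_Ioc_of_le (by linarith), smul_eq_mul,
      show β + (d : ℝ) = (β + d - 1) + 1 by ring, Real.rpow_add (half_pos hr), Real.rpow_one]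
    ring_nf
  have h4 : r ^ (β + d) = 2 ^ (β + d) * (r / 2) ^ (β + d) := by
    rw [← Real.mul_rpow (by norm_num) (by positivity)]; congr 1; ring
  rw [h4]
  have : K r * (r / 2) ^ (β + d) ≤ ∫ s in Ioi 0, K s * s ^ (β + d - 1) := by
    rw [← h3]; exact h1.trans h2
  calc K r * (2 ^ (β + d) * (r / 2) ^ (β + d)) = 2 ^ (β + d) * (K r * (r / 2) ^ (β + d)) := by ring
    _ ≤ _ := by gcongr

/-- Substitution `z = y - h • u`. -/
lemma integral_kernel_mul_density (f : (Fin d → ℝ) → ℝ) {h : ℝ} (hh : 0 < h) (y : Fin d → ℝ) :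
    ∫ z, K (N (y - z) / h) * f z = h ^ d * ∫ u, K (N u) * f (y - h • u) := by
  have h1 := Measure.integral_comp_inv_smul (volume : Measure (Fin d → ℝ))
    (fun u => K (N u) * f (y - h • u)) h
  rw [Module.finrank_fin_fun, abs_of_pos (pow_pos hh d), smul_eq_mul] at h1
  rw [← h1]
  refine Eq.trans ?_ (integral_sub_left_eq_self
    (fun x => K (N (h⁻¹ • x)) * f (y - h • h⁻¹ • x)) volume y)
  refine integral_congr_ae (Filter.Eventually.of_forall fun z => ?_)
  simp only [map_smul_eq_mul, norm_inv, Real.norm_of_nonneg hh.le, smul_inv_smul₀ hh.ne',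
    sub_sub_cancel, inv_mul_eq_div]

lemma integral_kernel_mul_comp_le (hK : IsSmoothingKernel N K) {f : (Fin d → ℝ) → ℝ} {M : ℝ}
    (hf0 : ∀ x, 0 ≤ f x) (hf : ∀ x, f x ≤ M) (h : ℝ) (y : Fin d → ℝ) :
    ∫ u, K (N u) * f (y - h • u) ≤ M := by
  have h1 : ∫ u, K (N u) * f (y - h • u) ≤ ∫ u : Fin d → ℝ, K (N u) * M := by
    refine integral_mono_of_nonneg (Filter.Eventually.of_forall fun u =>
      mul_nonneg (hK.nonneg _ (apply_nonneg N u)) (hf0 _)) (hK.integrable.mul_const M)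
      (Filter.Eventually.of_forall fun u => ?_)
    exact mul_le_mul_of_nonneg_left (hf _) (hK.nonneg _ (apply_nonneg N u))
  rwa [integral_mul_const, hK.integral_eq_one, one_mul] at h1

/-- The bias of kernel smoothing for a Hölder continuous density. -/
lemma abs_integral_kernel_mul_comp_sub_le (hK : IsSmoothingKernel N K) {f : (Fin d → ℝ) → ℝ}
    {M L α : ℝ} (hf0 : ∀ x, 0 ≤ f x) (hf : ∀ x, f x ≤ M) (hfc : Continuous f)
    (hL : ∀ x y, |f x - f y| ≤ L * N (x - y) ^ α)
    (hmom : Integrable (fun x : Fin d → ℝ => K (N x) * N x ^ α)) {h : ℝ} (hh : 0 < h)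
    (y : Fin d → ℝ) :
    |(∫ u, K (N u) * f (y - h • u)) - f y| ≤ L * h ^ α * ∫ u, K (N u) * N u ^ α := by
  have hi : Integrable fun u => K (N u) * f (y - h • u) := by
    refine hK.integrable.mul_bdd (c := M) ?_ ?_
    · exact (hfc.comp (continuous_const.sub (continuous_id.const_smul h))).aestronglyMeasurable
    · exact Filter.Eventually.of_forall fun u => by
        rw [Real.norm_of_nonneg (hf0 _)]; exact hf _
  have e : f y = ∫ u, K (N u) * f y := by
    rw [integral_mul_const, hK.integral_eq_one, one_mul]
  have e2 : (∫ u, K (N u) * f (y - h • u)) - f y = ∫ u, K (N u) * (f (y - h • u) - f y) := by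
    conv_lhs => rw [e, ← integral_sub hi (hK.integrable.mul_const (f y))]
    simp only [mul_sub]
  rw [e2, ← integral_const_mul]
  rw [← Real.norm_eq_abs]
  refine norm_integral_le_of_norm_le (hmom.const_mul _) (Filter.Eventually.of_forall fun u => ?_)
  have hk := hK.nonneg _ (apply_nonneg N u)
  rw [norm_mul, Real.norm_of_nonneg hk, Real.norm_eq_abs]
  have h2 := hL (y - h • u) y
  have e3 : N (y - h • u - y) = h * N u := by
    rw [sub_sub_cancel_left, map_neg_eq_map, map_smul_eq_mul, Real.norm_of_nonneg hh.le]
  rw [e3, Real.mul_rpow hh.le (apply_nonneg N u)] at h2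
  calc K (N u) * |f (y - h • u) - f y| ≤ K (N u) * (L * (h ^ α * N u ^ α)) := by gcongr
    _ = _ := by ring

end Kernel

/-- Division with remainder of `i - 1` by `k`: the remainder `a` names the progression, the quotient
`s` the position in it. -/
lemma sum_Icc_eq_sum_progressions {k n : ℕ} (hk : 1 ≤ k) (hkn : k ≤ n) (F : ℕ → ℝ) :
    ∑ i ∈ Finset.Icc 1 n, F i =
      ∑ a ∈ Finset.range k, ∑ s ∈ Finset.range ((n - 1 - a) / k + 1), F (a + 1 + k * s) := by
  rw [Finset.sum_sigma']
  symm
  refine Finset.sum_bij' (fun x _ => x.1 + 1 + k * x.2)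
    (fun i _ => (⟨(i - 1) % k, (i - 1) / k⟩ : Σ _ : ℕ, ℕ)) ?_ ?_ ?_ ?_ ?_
  · rintro ⟨a, s⟩ h
    simp only [Finset.mem_sigma, Finset.mem_range] at h
    have h2 : s ≤ (n - 1 - a) / k := by omega
    rw [Nat.le_div_iff_mul_le hk, mul_comm] at h2
    simp only [Finset.mem_Icc]
    omega
  · intro i h
    simp only [Finset.mem_Icc] at h
    simp only [Finset.mem_sigma, Finset.mem_range]
    refine ⟨Nat.mod_lt _ hk, Nat.lt_succ_of_le ?_⟩
    rw [Nat.le_div_iff_mul_le hk, mul_comm]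
    have := Nat.mod_add_div (i - 1) k
    omega
  · rintro ⟨a, s⟩ h
    simp only [Finset.mem_sigma, Finset.mem_range] at h
    have e : a + 1 + k * s - 1 = a + k * s := by omega
    simp only [e, Nat.add_mul_mod_self_left, Nat.mod_eq_of_lt h.1, Nat.add_mul_div_left a s hk,
      Nat.div_eq_of_lt h.1, zero_add]
  · intro i h
    simp only [Finset.mem_Icc] at h
    have := Nat.mod_add_div (i - 1) k
    simp only
    omega
  · intro _ _
    rfl

/-! ### Bernstein type inequality and pointwise concentration -/

section Mixing

variable {d : ℕ} {S : Set (Fin d → ℝ)} {Ω : Type*} [MeasurableSpace Ω]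

/-- A one-sided Bernstein type inequality for `C`-mixing processes. -/
lemma measure_sum_ge_le {μ : Measure Ω} [IsProbabilityMeasure μ] {X : ℕ → Ω → S}
    (hX : ∀ i, 1 ≤ i → Measurable (X i)) (hstat : IsStationary μ X)
    {C : Submodule ℝ (S → ℝ)} (hC : IsBoundedMeasurableClass C) {p : Seminorm ℝ C}
    (hp : SeminormAssumption C p) {k n : ℕ} (hk : 1 ≤ k) (hkn : k ≤ n) {r : ℝ} (hr : 0 ≤ r)
    (hmix : mixingCoeff μ X C p k ≤ (r : ℝ) ∨ mixingCoeffRev μ X C p k ≤ (r : ℝ))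
    {w : C} {A v δ : ℝ} (hw : ∀ y, |(w : S → ℝ) y| ≤ 1) (hA : p w ≤ A)
    (hv : ∫ ω, (w : S → ℝ) (X 1 ω) ^ 2 ∂μ ≤ v) (hvδ : v ≤ δ)
    (hn : n * (Real.exp 2 * (1 + A) * r) ≤ 1) :
    μ.real {ω | n * (∫ ω, (w : S → ℝ) (X 1 ω) ∂μ + δ) ≤
      ∑ i ∈ Finset.Icc 1 n, (w : S → ℝ) (X i ω)} ≤
        k * Real.exp (1 - n / (2 * k) * (δ - v)) := by
  have hA0 : 0 ≤ A := (apply_nonneg p w).trans hA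
  set m := ∫ ω, (w : S → ℝ) (X 1 ω) ∂μ with hm
  set l : ℕ → ℕ := fun a => (n - 1 - a) / k + 1 with hl
  have hsum : (n : ℝ) = ∑ a ∈ Finset.range k, (l a : ℝ) := by
    have := sum_Icc_eq_sum_progressions hk hkn (fun _ => (1 : ℝ))
    simpa [hl] using this
  -- The lengths `l a` add up to `n`, so if the whole sum is large, some progression reaches its
  -- proportional share.
  have hsub : {ω | n * (m + δ) ≤ ∑ i ∈ Finset.Icc 1 n, (w : S → ℝ) (X i ω)} ⊆
      ⋃ a ∈ Finset.range k, {ω | l a * (m + δ) ≤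
        ∑ s ∈ Finset.range (l a), (w : S → ℝ) (X (a + 1 + k * s) ω)} := by
    intro ω hω
    simp only [mem_ofPred_eq] at hω
    rw [sum_Icc_eq_sum_progressions hk hkn, hsum, Finset.sum_mul] at hω
    obtain ⟨a, ha, h⟩ := Finset.exists_le_of_sum_le (Finset.nonempty_range_iff.2 (by omega)) hω
    exact mem_biUnion ha h
  refine (measureReal_mono hsub (measure_ne_top _ _)).trans ((measureReal_biUnion_finset_le _ _).trans ?_)
  calc ∑ a ∈ Finset.range k, μ.real {ω | l a * (m + δ) ≤
        ∑ s ∈ Finset.range (l a), (w : S → ℝ) (X (a + 1 + k * s) ω)}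
      ≤ ∑ a ∈ Finset.range k, Real.exp (1 - n / (2 * k) * (δ - v)) := by
        refine Finset.sum_le_sum fun a ha => ?_
        have hak : a < k := Finset.mem_range.1 ha
        have hln : l a ≤ n := by
          have : (n - 1 - a) / k ≤ n - 1 - a := Nat.div_le_self _ _
          simp only [hl]; omega
        -- Here `n ≤ k * l a + a` and `a < k ≤ k * l a`.
        have hkl : n ≤ 2 * k * l a := by
          have h1 := Nat.lt_mul_div_succ (n - 1 - a) hk
          have h2 : k * 1 ≤ k * l a := Nat.mul_le_mul_left k (by simp [hl])
          have h3 : k * ((n - 1 - a) / k + 1) = k * l a := rfl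
          rw [mul_assoc]
          omega
        have hl' : (l a : ℝ) * (Real.exp 2 * (1 + A) * r) ≤ 1 := by
          refine le_trans ?_ hn
          gcongr
        refine (measure_sum_progression_ge_le hX hstat hC hp hr hmix hw hA hv hl'
          (i := a + 1) (by omega)).trans (Real.exp_le_exp.2 ?_)
        have h4 : (n : ℝ) / (2 * k) ≤ l a := by
          rw [div_le_iff₀ (by positivity)]
          have : (n : ℝ) ≤ ((2 * k * l a : ℕ) : ℝ) := by exact_mod_cast hkl
          push_cast at this
          linarith
        have h5 : n / (2 * k) * (δ - v) ≤ l a * (δ - v) :=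
          mul_le_mul_of_nonneg_right h4 (by linarith)
        linarith
    _ = _ := by simp

lemma measurable_kernel_comp {N : Seminorm ℝ (Fin d → ℝ)} {K : ℝ → ℝ}
    (hKc : Continuous fun x : Fin d → ℝ => K (N x)) {h : ℝ} (hh : 0 < h) (y : Fin d → ℝ) :
    Measurable fun z : Fin d → ℝ => K (N (y - z) / h) := by
  have e : (fun z : Fin d → ℝ => K (N (y - z) / h)) = fun z => K (N (h⁻¹ • (y - z))) := by
    funext z
    rw [map_smul_eq_mul, norm_inv, Real.norm_of_nonneg hh.le, inv_mul_eq_div]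
  rw [e]
  exact (hKc.comp ((continuous_const.sub continuous_id).const_smul h⁻¹)).measurable

lemma integral_kernel_comp_process {N : Seminorm ℝ (Fin d → ℝ)} {K : ℝ → ℝ}
    (hKc : Continuous fun x : Fin d → ℝ => K (N x)) {μ : Measure Ω} {X : ℕ → Ω → S}
    (hX : Measurable (X 1)) {f : (Fin d → ℝ) → ℝ} (hf0 : ∀ x, 0 ≤ f x) (hf : Measurable f)
    (hdens : μ.map (fun ω => (X 1 ω : Fin d → ℝ)) =
      volume.withDensity (fun x => ENNReal.ofReal (f x))) {h : ℝ} (hh : 0 < h) (y : Fin d → ℝ) :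
    ∫ ω, K (N (y - X 1 ω) / h) ∂μ = h ^ d * ∫ u, K (N u) * f (y - h • u) := by
  rw [← integral_kernel_mul_density f hh y]
  have h1 := integral_map (μ := μ) (φ := fun ω => (X 1 ω : Fin d → ℝ))
    (measurable_subtype_coe.comp hX).aemeasurable
    (measurable_kernel_comp hKc hh y).aestronglyMeasurable
  rw [← h1, hdens, integral_withDensity_eq_integral_toReal_smul hf.ennreal_ofReal
    (Filter.Eventually.of_forall fun x => ENNReal.ofReal_lt_top)]
  simp only [ENNReal.toReal_ofReal (hf0 _), smul_eq_mul, mul_comm]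

/-- Concentration of the kernel density estimator at a point. -/
lemma measure_abs_kde_sub_ge_le {N : Seminorm ℝ (Fin d → ℝ)} {K φ : ℝ → ℝ} {β : ℝ}
    {C : Submodule ℝ (S → ℝ)} {p : Seminorm ℝ C}
    (hC : IsBoundedMeasurableClass C) (hp : SeminormAssumption C p)
    (hK : IsSmoothingKernel N K) (hKC : KernelAssumption N K β C p φ)
    (hKc : Continuous fun x : Fin d → ℝ => K (N x))
    {μ : Measure Ω} [IsProbabilityMeasure μ] {X : ℕ → Ω → S}
    (hX : ∀ i, 1 ≤ i → Measurable (X i)) (hstat : IsStationary μ X)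
    {k n : ℕ} (hk : 1 ≤ k) (hkn : k ≤ n) {r : ℝ} (hr : 0 ≤ r)
    (hmix : mixingCoeff μ X C p k ≤ (r : ℝ) ∨ mixingCoeffRev μ X C p k ≤ (r : ℝ))
    {f : (Fin d → ℝ) → ℝ} (hf0 : ∀ x, 0 ≤ f x) (hf : Measurable f) {M : ℝ} (hM : ∀ x, f x ≤ M)
    (hdens : μ.map (fun ω => (X 1 ω : Fin d → ℝ)) =
      volume.withDensity (fun x => ENNReal.ofReal (f x)))
    {h α E : ℝ} (hh : 0 < h) (hh1 : h ≤ 1) (hα : 0 < α) (hE : M ≤ E)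
    (hn : n * (Real.exp 2 * (1 + φ h / K 0) * r) ≤ 1) (y : Fin d → ℝ) :
    μ.real {ω | E * h ^ α ≤ |kde N K X n h ω y - ∫ u, K (N u) * f (y - h • u)|} ≤
      2 * (k * Real.exp (1 - n * h ^ (2 * α + d) / (2 * k) * ((E - M) / K 0))) := by
  have hK0 := hK.zero_pos
  obtain ⟨hmem, hpφ⟩ := hKC.seminorm_le y h hh
  have hφ := hKC.φ_pos h hh
  have hn0 : 0 < n := by omega
  set I := ∫ u, K (N u) * f (y - h • u) with hI
  have hIM : I ≤ M := integral_kernel_mul_comp_le hK hf0 hM h y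
  have hhα : h ^ α ≤ 1 := Real.rpow_le_one hh.le hh1 hα.le
  have hhα0 : 0 < h ^ α := Real.rpow_pos_of_pos hh α
  -- With this scale `|w| ≤ h ^ α ≤ 1`, and a deviation `E * h ^ α` of the estimator becomes `E / K
  -- 0 * h ^ (2α + d)` per summand, comparable with the second moment.
  set t := h ^ α / K 0 with ht
  have ht0 : 0 < t := by positivity
  have hmean : ∫ ω, K (N (y - X 1 ω) / h) ∂μ = h ^ d * I :=
    integral_kernel_comp_process hKc (hX 1 le_rfl) hf0 hf hdens hh y
  have hkn0 : ∀ z, 0 ≤ K (N (y - z) / h) := fun z =>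
    hK.nonneg _ (div_nonneg (apply_nonneg N _) hh.le)
  have hkK : ∀ z, K (N (y - z) / h) ≤ K 0 := fun z =>
    hK.le_zero (div_nonneg (apply_nonneg N _) hh.le)
  have hmeas : Measurable fun ω => K (N (y - X 1 ω) / h) :=
    (measurable_kernel_comp hKc hh y).comp (measurable_subtype_coe.comp (hX 1 le_rfl))
  have hint : Integrable (fun ω => K (N (y - X 1 ω) / h)) μ :=
    Integrable.of_bound (C := K 0) hmeas.aestronglyMeasurable
      (Filter.Eventually.of_forall fun ω => by
        rw [Real.norm_of_nonneg (hkn0 _)]; exact hkK _)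
  -- From `K² ≤ K 0 * K` the second moment inherits the factor `h ^ d` of the mean.
  have hsq : ∫ ω, K (N (y - X 1 ω) / h) ^ 2 ∂μ ≤ K 0 * (h ^ d * M) := by
    have h1 : ∫ ω, K (N (y - X 1 ω) / h) ^ 2 ∂μ ≤ ∫ ω, K 0 * K (N (y - X 1 ω) / h) ∂μ := by
      refine integral_mono_of_nonneg (Filter.Eventually.of_forall fun ω => sq_nonneg _)
        (hint.const_mul _) (Filter.Eventually.of_forall fun ω => ?_)
      simp only [sq]
      exact mul_le_mul_of_nonneg_right (hkK _) (hkn0 _)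
    rw [integral_const_mul, hmean] at h1
    refine h1.trans ?_
    gcongr
  have hpow : h ^ (2 * α + d) = h ^ α * h ^ α * h ^ d := by
    rw [two_mul, Real.rpow_add hh, Real.rpow_add hh, Real.rpow_natCast]
  -- The signs `σ = 1` and `σ = -1` give the upper and the lower tail.
  have key : ∀ σ : ℝ, |σ| = 1 →
      μ.real {ω | n * (σ * t * (h ^ d * I) + E / K 0 * h ^ (2 * α + d)) ≤
        ∑ i ∈ Finset.Icc 1 n, σ * t * K (N (y - X i ω) / h)} ≤
      k * Real.exp (1 - n * h ^ (2 * α + d) / (2 * k) * ((E - M) / K 0)) := by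
    intro σ hσ
    have hσ2 : σ ^ 2 = 1 := by rw [← sq_abs, hσ, one_pow]
    have h1 := measure_sum_ge_le hX hstat hC hp hk hkn hr hmix
      (w := (σ * t) • ⟨_, hmem⟩) (A := φ h / K 0) (v := M / K 0 * h ^ (2 * α + d))
      (δ := E / K 0 * h ^ (2 * α + d)) (fun z => ?_) ?_ ?_ ?_ hn
    · simp only [Submodule.coe_smul, Pi.smul_apply, smul_eq_mul, integral_const_mul, hmean] at h1
      convert h1 using 4
      ring
    · simp only [Submodule.coe_smul, Pi.smul_apply, smul_eq_mul]
      rw [abs_mul, abs_mul, hσ, one_mul, abs_of_pos ht0, abs_of_nonneg (hkn0 _)]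
      calc t * K (N (y - z) / h) ≤ t * K 0 := by gcongr; exact hkK _
        _ = h ^ α := by rw [ht]; field_simp
        _ ≤ 1 := hhα
    · rw [map_smul_eq_mul, Real.norm_eq_abs, abs_mul, hσ, one_mul, abs_of_pos ht0]
      calc t * p ⟨_, hmem⟩ ≤ 1 / K 0 * φ h := by rw [ht]; gcongr
        _ = _ := by ring
    · simp only [Submodule.coe_smul, Pi.smul_apply, smul_eq_mul, mul_pow, hσ2, one_mul,
        integral_const_mul]
      calc t ^ 2 * ∫ ω, K (N (y - X 1 ω) / h) ^ 2 ∂μ ≤ t ^ 2 * (K 0 * (h ^ d * M)) := by gcongr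
        _ = _ := by rw [ht, hpow]; field_simp
    · gcongr
  have hsub : {ω | E * h ^ α ≤ |kde N K X n h ω y - I|} ⊆
      {ω | n * (1 * t * (h ^ d * I) + E / K 0 * h ^ (2 * α + d)) ≤
        ∑ i ∈ Finset.Icc 1 n, 1 * t * K (N (y - X i ω) / h)} ∪
      {ω | n * (-1 * t * (h ^ d * I) + E / K 0 * h ^ (2 * α + d)) ≤
        ∑ i ∈ Finset.Icc 1 n, -1 * t * K (N (y - X i ω) / h)} := by
    intro ω hω
    simp only [mem_ofPred_eq, kde] at hω
    simp only [mem_union, mem_ofPred_eq, ← Finset.mul_sum]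
    set s := ∑ i ∈ Finset.Icc 1 n, K (N (y - X i ω) / h)
    have hq : 0 < n * h ^ d * t := by positivity
    have e1 : (n * h ^ d * t) * (E * h ^ α) = n * (E / K 0 * h ^ (2 * α + d)) := by
      rw [hpow, ht]; field_simp
    have e2 : (n * h ^ d * t) * (1 / (n * h ^ d) * s - I) = t * s - n * (t * (h ^ d * I)) := by
      field_simp
    rcases le_abs.1 hω with h1 | h1
    · left
      have := mul_le_mul_of_nonneg_left h1 hq.le
      rw [e1, e2] at this
      linarith
    · right
      have := mul_le_mul_of_nonneg_left h1 hq.le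
      rw [mul_neg, e1, e2] at this
      linarith
  refine (measureReal_mono hsub).trans ((measureReal_union_le _ _).trans ?_)
  have := key 1 (by norm_num)
  have := key (-1) (by norm_num)
  linarith

end Mixing

/-! ### Deterministic passage from the net to all points -/

section Deterministic

variable {d : ℕ} {S : Set (Fin d → ℝ)} {Ω : Type*} {N : Seminorm ℝ (Fin d → ℝ)} {K : ℝ → ℝ}

lemma abs_average_kernel_sub_le {n : ℕ} (hn : 0 < n) {h B : ℝ} (hh : 0 < h) {F G : ℕ → ℝ}
    (hFG : ∀ i ∈ Finset.Icc 1 n, |F i - G i| ≤ h ^ d * B) :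
    |1 / (n * h ^ d) * ∑ i ∈ Finset.Icc 1 n, F i -
      1 / (n * h ^ d) * ∑ i ∈ Finset.Icc 1 n, G i| ≤ B := by
  have hn' : (0 : ℝ) < n := by exact_mod_cast hn
  have hq : 0 < n * h ^ d := by positivity
  rw [← mul_sub, ← Finset.sum_sub_distrib, abs_mul, abs_of_pos (by positivity), one_div,
    inv_mul_le_iff₀ hq]
  calc |∑ i ∈ Finset.Icc 1 n, (F i - G i)| ≤ ∑ i ∈ Finset.Icc 1 n, |F i - G i| :=
        Finset.abs_sum_le_sum_abs _ _
    _ ≤ ∑ i ∈ Finset.Icc 1 n, h ^ d * B := Finset.sum_le_sum hFG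
    _ = n * h ^ d * B := by simp [mul_assoc]

lemma abs_kde_le {X : ℕ → Ω → S} {n : ℕ} (hn : 0 < n) {h B : ℝ} (hh : 0 < h) {ω : Ω}
    {x : Fin d → ℝ} (hB : ∀ i ∈ Finset.Icc 1 n, |K (N (x - X i ω) / h)| ≤ h ^ d * B) :
    |kde N K X n h ω x| ≤ B := by
  have := abs_average_kernel_sub_le hn hh (F := fun i => K (N (x - X i ω) / h)) (G := fun _ => 0)
    (B := B) (by simpa using hB)
  simpa [kde] using this

lemma abs_kde_sub_kde_le {L β : ℝ} (hL : 0 ≤ L) (hβ : 0 ≤ β)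
    (hol : ∀ r s, 0 ≤ r → 0 ≤ s → |K r - K s| ≤ L * |r - s| ^ β)
    {X : ℕ → Ω → S} {n : ℕ} (hn : 0 < n) {h D : ℝ} (hh : 0 < h) (ω : Ω) {x y : Fin d → ℝ}
    (hD : (N (x - y) / h) ^ β ≤ h ^ d * D) :
    |kde N K X n h ω x - kde N K X n h ω y| ≤ L * D := by
  refine abs_average_kernel_sub_le hn hh fun i _ => ?_
  refine (hol _ _ (div_nonneg (apply_nonneg N _) hh.le) (div_nonneg (apply_nonneg N _) hh.le)).trans ?_
  have h1 : |N (x - X i ω) / h - N (y - X i ω) / h| ≤ N (x - y) / h := by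
    rw [← sub_div, abs_div, abs_of_pos hh]
    have := abs_sub_map_le_sub N (x - X i ω) (y - X i ω)
    rw [sub_sub_sub_cancel_right] at this
    gcongr
  calc L * |N (x - X i ω) / h - N (y - X i ω) / h| ^ β ≤ L * (N (x - y) / h) ^ β := by gcongr
    _ ≤ L * (h ^ d * D) := by gcongr
    _ = _ := by ring

/-- Each observation is at distance at least `1` from `x`, so each summand is at most `K (1 / h) ≤ B
* h ^ (β + d)`, which pays for the factor `h ^ (-d)`. -/
lemma abs_kde_le_of_far (hK : IsSmoothingKernel N K) {α β B : ℝ} (hαβ : α ≤ β)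
    (hB0 : 0 ≤ B) (hB : ∀ r, 0 < r → K r * r ^ (β + d) ≤ B)
    {X : ℕ → Ω → S} {n : ℕ} (hn : 0 < n) {h : ℝ} (hh : 0 < h) (hh1 : h ≤ 1) {ω : Ω} {r₀ : ℝ}
    (hω : ∀ i ∈ Finset.Icc 1 n, N (X i ω) ≤ r₀) {x : Fin d → ℝ} (hx : r₀ + 1 ≤ N x) :
    |kde N K X n h ω x| ≤ B * h ^ α := by
  refine abs_kde_le hn hh fun i hi => ?_
  have hnn : 0 ≤ N (x - X i ω) / h := div_nonneg (apply_nonneg N _) hh.le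
  rw [abs_of_nonneg (hK.nonneg _ hnn)]
  have h1 : 1 / h ≤ N (x - X i ω) / h := by
    have h3 : N x ≤ N (x - X i ω) + N (X i ω) := by
      simpa using map_add_le_add N (x - X i ω) (X i ω)
    have := hω i hi
    gcongr
    linarith
  have h4 : K (N (x - X i ω) / h) ≤ K (1 / h) :=
    hK.antitone (mem_Ici.2 (by positivity)) (mem_Ici.2 hnn) h1
  have h5 := hB (1 / h) (by positivity)
  rw [one_div, Real.inv_rpow hh.le, ← div_eq_mul_inv, div_le_iff₀ (by positivity),
    Real.rpow_add hh, Real.rpow_natCast, ← one_div] at h5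
  have h6 : h ^ β ≤ h ^ α := Real.rpow_le_rpow_of_exponent_ge hh hh1 hαβ
  calc K (N (x - X i ω) / h) ≤ B * (h ^ β * h ^ d) := h4.trans h5
    _ ≤ B * (h ^ α * h ^ d) := by gcongr
    _ = _ := by ring

/-- By continuity, the part of `{f > 0}` outside the ball is open; being Lebesgue null, it is empty.
-/
lemma density_eq_zero_of_far {ν : Measure (Fin d → ℝ)} {f : (Fin d → ℝ) → ℝ}
    (hf0 : ∀ x, 0 ≤ f x) (hfc : Continuous f)
    (hdens : ν = volume.withDensity (fun x => ENNReal.ofReal (f x))) {r₀ : ℝ}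
    (hsupp : ν {x | r₀ < N x} = 0) {x : Fin d → ℝ} (hx : r₀ < N x) : f x = 0 := by
  by_contra hne
  have hpos : 0 < f x := (hf0 x).lt_of_ne (Ne.symm hne)
  rw [hdens, withDensity_apply_eq_zero hfc.measurable.ennreal_ofReal] at hsupp
  have hU : IsOpen ({x | 0 < f x} ∩ {x | r₀ < N x}) :=
    (isOpen_lt continuous_const hfc).inter (isOpen_lt continuous_const (continuous_seminorm N))
  refine (hU.measure_pos volume ⟨x, hpos, hx⟩).ne' (measure_mono_null ?_ hsupp)
  rintro z ⟨hz1, hz2⟩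
  exact ⟨(ENNReal.ofReal_pos.2 hz1).ne', hz2⟩

/-- Passage from a net to the whole space. -/
lemma abs_kde_sub_density_le (hK : IsSmoothingKernel N K) {α β L Lf M B E : ℝ} (hα : 0 < α)
    (hαβ : α ≤ β) (hL : 0 ≤ L) (hLf : 0 ≤ Lf) (hE : 0 ≤ E)
    (hol : ∀ r s, 0 ≤ r → 0 ≤ s → |K r - K s| ≤ L * |r - s| ^ β)
    (hB0 : 0 ≤ B) (hB : ∀ r, 0 < r → K r * r ^ (β + d) ≤ B)
    (hmom : Integrable (fun x : Fin d → ℝ => K (N x) * N x ^ α))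
    {f : (Fin d → ℝ) → ℝ} (hf0 : ∀ x, 0 ≤ f x) (hM : ∀ x, f x ≤ M)
    (hfα : ∀ x y, |f x - f y| ≤ Lf * N (x - y) ^ α)
    {r₀ : ℝ} (hfar : ∀ x, r₀ < N x → f x = 0)
    {X : ℕ → Ω → S} {n : ℕ} (hn : 0 < n) {h : ℝ} (hh : 0 < h) (hh1 : h ≤ 1) {ω : Ω}
    (hω : ∀ i ∈ Finset.Icc 1 n, N (X i ω) ≤ r₀) {T : Finset (Fin d → ℝ)}
    (hT : ∀ x, N x ≤ r₀ + 1 → ∃ y ∈ T, N (x - y) ≤ h ^ (1 + (d + α) / β))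
    (hconc : ∀ y ∈ T, |kde N K X n h ω y - ∫ u, K (N u) * f (y - h • u)| ≤ E * h ^ α)
    (x : Fin d → ℝ) :
    |kde N K X n h ω x - f x| ≤
      (L + E + Lf * (∫ u, K (N u) * N u ^ α) + Lf + B) * h ^ α := by
  have hβ : 0 < β := hα.trans_le hαβ
  have hhα : 0 < h ^ α := Real.rpow_pos_of_pos hh α
  have hI : 0 ≤ ∫ u, K (N u) * N u ^ α := integral_nonneg fun u =>
    mul_nonneg (hK.nonneg _ (apply_nonneg N u)) (Real.rpow_nonneg (apply_nonneg N u) _)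
  have hfc : Continuous f := continuous_of_abs_sub_le_rpow hα hfα
  rcases le_or_gt (N x) (r₀ + 1) with hx | hx
  · obtain ⟨y, hy, hxy⟩ := hT x hx
    have hexp : h ^ (1 + (d + α) / β) = h * h ^ ((d + α) / β) := by
      rw [Real.rpow_add hh, Real.rpow_one]
    -- The mesh exponent is chosen for this: `(h ^ ((d + α) / β)) ^ β = h ^ d * h ^ α`, and `h ^ d`
    -- cancels the normalisation of the estimator.
    have h1 : |kde N K X n h ω x - kde N K X n h ω y| ≤ L * h ^ α := by
      refine abs_kde_sub_kde_le hL hβ.le hol hn hh ω ?_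
      have h2 : N (x - y) / h ≤ h ^ ((d + α) / β) := by
        rw [div_le_iff₀ hh, mul_comm, ← hexp]; exact hxy
      calc (N (x - y) / h) ^ β ≤ (h ^ ((d + α) / β)) ^ β :=
            Real.rpow_le_rpow (div_nonneg (apply_nonneg N _) hh.le) h2 hβ.le
        _ = h ^ d * h ^ α := by
            rw [← Real.rpow_mul hh.le, div_mul_cancel₀ _ hβ.ne', Real.rpow_add hh,
              Real.rpow_natCast]
    have h2 := hconc y hy
    have h3 := abs_integral_kernel_mul_comp_sub_le hK hf0 hM hfc hfα hmom hh y
    have h4 : |f x - f y| ≤ Lf * h ^ α := by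
      refine (hfα x y).trans ?_
      have h5 : N (x - y) ≤ h := hxy.trans (by
        rw [hexp]
        exact mul_le_of_le_one_right hh.le (Real.rpow_le_one hh.le hh1 (by positivity)))
      have := Real.rpow_le_rpow (apply_nonneg N _) h5 hα.le
      gcongr
    have h6 : 0 ≤ B * h ^ α := by positivity
    -- Triangle inequality along estimator at `x`, estimator at `y`, its mean, `f y`, `f x`; the
    -- term with `B` is slack here.
    rw [abs_le] at *
    constructor <;> nlinarith
  · rw [hfar x (by linarith), sub_zero]
    refine (abs_kde_le_of_far hK hαβ hB0 hB hn hh hh1 hω hx.le).trans ?_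
    have : 0 ≤ Lf * ∫ u, K (N u) * N u ^ α := by positivity
    gcongr
    linarith

end Deterministic

/-! ### Asymptotics of logarithms and the threshold -/

section Rate

open Filter Asymptotics Topology

lemma logRate_nonneg (γ : ℝ) (n : ℕ) : 0 ≤ logRate γ n :=
  div_nonneg (Real.rpow_nonneg (Real.log_natCast_nonneg n) _) n.cast_nonneg

lemma logRate_pos (γ : ℝ) {n : ℕ} (hn : 2 ≤ n) : 0 < logRate γ n := by
  have : (1 : ℝ) < n := by exact_mod_cast hn
  exact div_pos (Real.rpow_pos_of_pos (Real.log_pos this) _) (by linarith)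

lemma eventually_mul_log_rpow_le (s B : ℝ) :
    ∀ᶠ n : ℕ in atTop, B * Real.log n ^ s ≤ n := by
  have h1 := (isLittleO_log_rpow_rpow_atTop s (one_pos)).comp_tendsto tendsto_natCast_atTop_atTop
  have hc : (0 : ℝ) < 1 / (|B| + 1) := by positivity
  filter_upwards [h1.def hc] with n hn
  simp only [Function.comp_apply, Real.rpow_one, Real.norm_natCast] at hn
  have h2 : 0 ≤ Real.log n ^ s := Real.rpow_nonneg (Real.log_natCast_nonneg n) _
  rw [Real.norm_of_nonneg h2, one_div, inv_mul_eq_div, le_div_iff₀ (by positivity)] at hn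
  have := mul_le_mul_of_nonneg_right (le_abs_self B) h2
  linarith

lemma eventually_le_log (B : ℝ) : ∀ᶠ n : ℕ in atTop, B ≤ Real.log n :=
  (Real.tendsto_log_atTop.comp tendsto_natCast_atTop_atTop).eventually_ge_atTop B

lemma pow_lower_bound_of_threshold_le {d n : ℕ} {K φ : ℝ → ℝ} {c₀ b γ h : ℝ} (hc₀ : 0 < c₀)
    (hK0 : 0 < K 0) (hh : 0 < h) (hφ : 0 < φ h)
    (hn : threshold d K φ c₀ b γ h ≤ n) :
    808 * c₀ * (3 * (φ h / h ^ d) + K 0) / (2 * K 0) ≤ (n : ℝ) ^ (d + 1) := by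
  have h1 := (le_max_left _ _).trans hn
  set s : Set ℕ := {m : ℕ | 3 ≤ m ∧
      (808 * c₀ * (3 * (φ h / h ^ d) + K 0) / (2 * K 0)) ^ (1 / ((d : ℝ) + 1)) ≤ m ∧
      4 ≤ (m : ℝ) / Real.log m ^ (2 / γ)} with hs
  -- The infimum of the empty set in `ℕ` is `0`, so the minimum satisfies its conditions only once
  -- the set is known to be nonempty.
  have hne : s.Nonempty := by
    have h2 := (eventually_mul_log_rpow_le (2 / γ) 4).and ((eventually_ge_atTop 3).and
      ((tendsto_natCast_atTop_atTop (R := ℝ)).eventually_ge_atTop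
        ((808 * c₀ * (3 * (φ h / h ^ d) + K 0) / (2 * K 0)) ^ (1 / ((d : ℝ) + 1)))))
    obtain ⟨m, hm1, hm2, hm3⟩ := h2.exists
    refine ⟨m, hm2, hm3, ?_⟩
    have : (1 : ℝ) < m := by exact_mod_cast (by omega : 1 < m)
    rwa [le_div_iff₀ (Real.rpow_pos_of_pos (Real.log_pos this) _)]
  have h3 := (Nat.sInf_mem hne).2.1.trans h1
  have hx : 0 ≤ 808 * c₀ * (3 * (φ h / h ^ d) + K 0) / (2 * K 0) := by positivity
  have h4 := pow_le_pow_left₀ (Real.rpow_nonneg hx _) h3 (d + 1)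
  rwa [← Real.rpow_natCast, ← Real.rpow_mul hx, show (1 / ((d : ℝ) + 1)) * ((d + 1 : ℕ) : ℝ) = 1 by
    push_cast; field_simp, Real.rpow_one] at h4

lemma two_le_of_threshold_le {d n : ℕ} {K φ : ℝ → ℝ} {c₀ b γ h : ℝ} (hb : 0 < b)
    (hn : threshold d K φ c₀ b γ h ≤ n) : 2 ≤ n := by
  have h1 := (le_max_right _ _).trans hn
  have h2 : 1 < Real.exp (((d : ℝ) + 1) / b) := Real.one_lt_exp_iff.2 (by positivity)
  have : (1 : ℝ) < n := h2.trans_le h1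
  exact_mod_cast this

end Rate

/-! ### Choice of bandwidth and step -/

section Rate

open Filter

/-- The step of the progressions into which the sample is split. -/
noncomputable def blockStep (γ : ℝ) (n : ℕ) : ℕ := ⌈Real.log n ^ (2 / γ)⌉₊

lemma bandwidth_rpow {d n : ℕ} {α γ : ℝ} (hα : 0 < α) :
    bandwidth d α γ n ^ (2 * α + d) = logRate γ n := by
  have : (0 : ℝ) < 2 * α + d := by positivity
  rw [bandwidth, ← Real.rpow_mul (logRate_nonneg γ n), one_div, inv_mul_cancel₀ this.ne',
    Real.rpow_one]

lemma bandwidth_rpow_alpha (d n : ℕ) (α γ : ℝ) :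
    bandwidth d α γ n ^ α = logRate γ n ^ (α / (2 * α + d)) := by
  rw [bandwidth, ← Real.rpow_mul (logRate_nonneg γ n), one_div, inv_mul_eq_div]

lemma bandwidth_pos {d n : ℕ} {α γ : ℝ} (hn : 2 ≤ n) : 0 < bandwidth d α γ n :=
  Real.rpow_pos_of_pos (logRate_pos γ hn) _

lemma bandwidth_nonneg (d n : ℕ) (α γ : ℝ) : 0 ≤ bandwidth d α γ n :=
  Real.rpow_nonneg (logRate_nonneg γ n) _

lemma bandwidth_le_one {d n : ℕ} {α γ : ℝ} (hα : 0 < α) (hn : logRate γ n ≤ 1) :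
    bandwidth d α γ n ≤ 1 :=
  Real.rpow_le_one (logRate_nonneg γ n) hn (by positivity)

/-- Converts net sizes polynomial in `1 / h` into powers of `n`; `1 / (2α + d) ≤ 1` because `d ≥ 1`.
-/
lemma inv_le_bandwidth {d n : ℕ} {α γ : ℝ} (hd : 1 ≤ d) (hα : 0 < α) (hγ : 0 < γ) (hn : 2 ≤ n)
    (hlog : 1 ≤ Real.log n) : (n : ℝ)⁻¹ ≤ bandwidth d α γ n := by
  have hn0 : (0 : ℝ) < n := by exact_mod_cast (by omega : 0 < n)
  have hn1 : (1 : ℝ) ≤ n := by exact_mod_cast (by omega : 1 ≤ n)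
  have hd' : (1 : ℝ) ≤ d := by exact_mod_cast hd
  have h1 : (n : ℝ)⁻¹ ≤ logRate γ n := by
    rw [logRate, div_eq_mul_inv]
    exact le_mul_of_one_le_left (by positivity) (Real.one_le_rpow hlog (by positivity))
  calc (n : ℝ)⁻¹ = (n : ℝ)⁻¹ ^ (1 : ℝ) := (Real.rpow_one _).symm
    _ ≤ (n : ℝ)⁻¹ ^ (1 / (2 * α + d)) := by
      refine Real.rpow_le_rpow_of_exponent_ge (by positivity) (inv_le_one_of_one_le₀ hn1) ?_
      rw [div_le_one (by positivity)]
      linarith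
    _ ≤ _ := Real.rpow_le_rpow (by positivity) h1 (by positivity)

lemma blockStep_le {γ : ℝ} {n : ℕ} (hγ : 0 < γ) (hlog : 1 ≤ Real.log n) :
    (blockStep γ n : ℝ) ≤ 2 * Real.log n ^ (2 / γ) := by
  have h0 : 1 ≤ Real.log n ^ (2 / γ) := Real.one_le_rpow hlog (by positivity)
  have := Nat.ceil_lt_add_one (zero_le_one.trans h0)
  rw [blockStep]
  linarith

lemma sq_log_le_blockStep_rpow {γ : ℝ} {n : ℕ} (hγ : 0 < γ) (hlog : 1 ≤ Real.log n) :
    Real.log n ^ 2 ≤ (blockStep γ n : ℝ) ^ γ := by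
  have h0 : 0 ≤ Real.log n := by linarith
  have := Real.rpow_le_rpow (Real.rpow_nonneg h0 _) (Nat.le_ceil (Real.log n ^ (2 / γ))) hγ.le
  rwa [← Real.rpow_mul h0, div_mul_cancel₀ _ hγ.ne', Real.rpow_two] at this

lemma one_le_blockStep {γ : ℝ} {n : ℕ} (hlog : 1 ≤ Real.log n) : 1 ≤ blockStep γ n :=
  Nat.one_le_ceil_iff.2 (Real.rpow_pos_of_pos (by linarith) _)

/-- The bandwidth solves `n h^(2α+d) = (log n)^(1 + 2/γ)`; dividing by `2k ≤ 4 (log n)^(2/γ)` leaves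
one logarithm. -/
lemma log_le_mul_bandwidth_rpow_div {d n : ℕ} {α γ : ℝ} (hα : 0 < α) (hγ : 0 < γ) (hn : 2 ≤ n)
    (hlog : 1 ≤ Real.log n) :
    Real.log n / 4 ≤ n * bandwidth d α γ n ^ (2 * α + d) / (2 * blockStep γ n) := by
  have hn0 : (0 : ℝ) < n := by exact_mod_cast (by omega : 0 < n)
  have hl0 : 0 < Real.log n := by linarith
  have hk : (0 : ℝ) < blockStep γ n := by exact_mod_cast one_le_blockStep hlog
  rw [bandwidth_rpow hα, logRate, mul_div_cancel₀ _ hn0.ne', le_div_iff₀ (by positivity),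
    show (2 + γ) / γ = 1 + 2 / γ by field_simp; ring, Real.rpow_add hl0, Real.rpow_one]
  have := mul_le_mul_of_nonneg_left (blockStep_le hγ hlog) hl0.le
  linarith

/-- The threshold gives `c₀ φ(h) / K 0 ≤ n^(d+1)`, and `b k^γ ≥ b (log n)² ≥ (d + 3) log n` gives a
decay of `n^(-(d+3))`. With the factor `n` for the sample size, a constant over `n` remains. -/
lemma mixing_error_le_one {d n : ℕ} {K φ : ℝ → ℝ} {c₀ b γ h : ℝ} (hc₀ : 0 < c₀) (hb : 0 < b)
    (hγ : 0 < γ) (hK0 : 0 < K 0) (hh : 0 < h) (hh1 : h ≤ 1) (hφ : 0 < φ h)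
    (hthr : threshold d K φ c₀ b γ h ≤ n) (hlog : 1 ≤ Real.log n)
    (hlogb : (d + 3) / b ≤ Real.log n) (hn : Real.exp 2 * (c₀ + 1) ≤ n) :
    n * (Real.exp 2 * (1 + φ h / K 0) *
      (c₀ * Real.exp (-b * (blockStep γ n : ℝ) ^ γ))) ≤ 1 := by
  have hn2 := two_le_of_threshold_le hb hthr
  have hn0 : (0 : ℝ) < n := by exact_mod_cast (by omega : 0 < n)
  have hn1 : (1 : ℝ) ≤ n := by exact_mod_cast (by omega : 1 ≤ n)
  have h1 : c₀ * (φ h / K 0) ≤ (n : ℝ) ^ (d + 1) := by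
    refine le_trans ?_ (pow_lower_bound_of_threshold_le hc₀ hK0 hh hφ hthr)
    have h2 : φ h ≤ φ h / h ^ d := le_div_self hφ.le (by positivity) (pow_le_one₀ hh.le hh1)
    have h3 : c₀ * φ h ≤ c₀ * (φ h / h ^ d) := by gcongr
    have h4 : 0 < c₀ * K 0 := by positivity
    have h5 : 0 < c₀ * φ h := by positivity
    rw [← mul_div_assoc, div_le_div_iff₀ hK0 (by positivity)]
    nlinarith
  have h2 : Real.exp (-b * (blockStep γ n : ℝ) ^ γ) ≤ ((n : ℝ) ^ (d + 3))⁻¹ := by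
    have e : ((n : ℝ) ^ (d + 3))⁻¹ = Real.exp (-(((d + 3 : ℕ) : ℝ) * Real.log n)) := by
      rw [Real.exp_neg, Real.exp_nat_mul, Real.exp_log hn0]
    rw [e]
    refine Real.exp_le_exp.2 ?_
    rw [div_le_iff₀ hb] at hlogb
    have h3 := mul_le_mul_of_nonneg_left (sq_log_le_blockStep_rpow hγ hlog) hb.le
    have h4 := mul_le_mul_of_nonneg_right hlogb (by linarith : 0 ≤ Real.log n)
    push_cast
    nlinarith
  have h3 : c₀ * (1 + φ h / K 0) ≤ (c₀ + 1) * (n : ℝ) ^ (d + 1) := by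
    have := one_le_pow₀ hn1 (n := d + 1)
    nlinarith
  calc n * (Real.exp 2 * (1 + φ h / K 0) * (c₀ * Real.exp (-b * (blockStep γ n : ℝ) ^ γ)))
      = n * Real.exp 2 * (c₀ * (1 + φ h / K 0)) * Real.exp (-b * (blockStep γ n : ℝ) ^ γ) := by ring
    _ ≤ n * Real.exp 2 * ((c₀ + 1) * (n : ℝ) ^ (d + 1)) * ((n : ℝ) ^ (d + 3))⁻¹ := by gcongr
    _ = Real.exp 2 * (c₀ + 1) / n := by
      rw [pow_add, pow_add]; field_simp
    _ ≤ 1 := (div_le_one hn0).2 hn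

/-- The decay `n^(-(qd+3))` pays `n^(qd)` for the net and `n` for the progressions; one more power
of `n` absorbs the constants, leaving `1 / n`. -/
lemma net_card_mul_exp_le {d n : ℕ} {B h q k t : ℝ} (hB : 0 < B) (hq : 0 ≤ q)
    (hn : 0 < n) (hh : (n : ℝ)⁻¹ ≤ h) (hk0 : 0 ≤ k) (hk : k ≤ n)
    (ht : (q * d + 3) * Real.log n ≤ t) (hBn : B ^ d * (2 * Real.exp 1) ≤ n) :
    (B / h ^ q) ^ d * (2 * (k * Real.exp (1 - t))) ≤ 1 / n := by
  have hn0 : (0 : ℝ) < n := by exact_mod_cast hn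
  have hh0 : 0 < h := (inv_pos.2 hn0).trans_le hh
  have h1 : B / h ^ q ≤ B * (n : ℝ) ^ q := by
    rw [div_eq_mul_inv, ← Real.inv_rpow hh0.le]
    gcongr
    exact inv_le_of_inv_le₀ hn0 hh
  have h2 : Real.exp (1 - t) ≤ Real.exp 1 / (((n : ℝ) ^ q) ^ d * (n : ℝ) ^ 3) := by
    have e : ((n : ℝ) ^ q) ^ d * (n : ℝ) ^ 3 = Real.exp ((q * d + 3) * Real.log n) := by
      rw [← Real.rpow_natCast, ← Real.rpow_mul hn0.le, ← Real.rpow_natCast, ← Real.rpow_add hn0,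
        Real.rpow_def_of_pos hn0, mul_comm]
      norm_num
    rw [e, ← Real.exp_sub]
    exact Real.exp_le_exp.2 (by linarith)
  calc (B / h ^ q) ^ d * (2 * (k * Real.exp (1 - t)))
      ≤ (B * (n : ℝ) ^ q) ^ d *
        (2 * (n * (Real.exp 1 / (((n : ℝ) ^ q) ^ d * (n : ℝ) ^ 3)))) := by gcongr
    _ = B ^ d * (2 * Real.exp 1) / n ^ 2 := by
      rw [mul_pow]; field_simp
    _ ≤ n / n ^ 2 := by gcongr
    _ = 1 / n := by field_simp

end Rate

end CMixingKDE

/-! ### The main theorem -/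

open CMixingKDE

theorem mainTheorem3
    {d : ℕ} (hd : 1 ≤ d)
    -- an arbitrary norm on `ℝ^d`
    (N : Seminorm ℝ (Fin d → ℝ)) (hN : ∀ x, N x = 0 → x = 0)
    -- the state space, the function class and its semi-norm
    (S : Set (Fin d → ℝ)) (C : Submodule ℝ (S → ℝ)) (p : Seminorm ℝ C)
    (hC : CMixingKDE.IsBoundedMeasurableClass C) (hp : CMixingKDE.SeminormAssumption C p)
    -- the kernel
    (K φ : ℝ → ℝ) (β : ℝ) (hK : CMixingKDE.IsSmoothingKernel N K)
    (hKC : CMixingKDE.KernelAssumption N K β C p φ)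
    -- the process
    {Ω : Type*} [MeasurableSpace Ω] (μ : Measure Ω) [IsProbabilityMeasure μ]
    (X : ℕ → Ω → S) (hX : ∀ i, 1 ≤ i → Measurable (X i))
    (hstat : CMixingKDE.IsStationary μ X)
    (c₀ b γ : ℝ) (hc₀ : 0 < c₀) (hb : 0 < b) (hγ : 0 < γ)
    (hmix : CMixingKDE.IsGeomMixing μ X C p c₀ b γ)
    -- the density of `X 1`: bounded, Hölder continuous on `ℝ^d`, supported in a ball
    (f : (Fin d → ℝ) → ℝ) (hf : ∀ x, 0 ≤ f x)
    (hdens : μ.map (fun ω => (X 1 ω : Fin d → ℝ)) =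
      volume.withDensity (fun x => ENNReal.ofReal (f x)))
    (hfbdd : ∃ M : ℝ, ∀ x, f x ≤ M)
    (α : ℝ) (hα : 0 < α) (hαβ : α ≤ β)
    (hfα : ∃ L : ℝ, ∀ x y, |f x - f y| ≤ L * N (x - y) ^ α)
    (r₀ : ℝ) (hr₀ : 1 ≤ r₀)
    (hsupp : μ.map (fun ω => (X 1 ω : Fin d → ℝ)) {x | r₀ < N x} = 0) :
    ∃ c : ℝ, 0 < c ∧ ∀ n : ℕ,
      CMixingKDE.threshold d K φ c₀ b γ (CMixingKDE.bandwidth d α γ n) ≤ n →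
      1 - 1 / (n : ℝ) ≤
        μ.real {ω | CMixingKDE.supNorm
            (fun x => CMixingKDE.kde N K X n (CMixingKDE.bandwidth d α γ n) ω x - f x) ≤
          ENNReal.ofReal (c * CMixingKDE.logRate γ n ^ (α / (2 * α + d)))} := by
  have hβ : 0 < β := hα.trans_le hαβ
  have hK0 := hK.zero_pos
  obtain ⟨M, hM⟩ := hfbdd
  have hM0 : 0 ≤ M := (hf 0).trans (hM 0)
  obtain ⟨Lf, hLf0, hLf⟩ : ∃ L : ℝ, 0 ≤ L ∧ ∀ x y, |f x - f y| ≤ L * N (x - y) ^ α := by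
    obtain ⟨L, hL⟩ := hfα
    exact ⟨|L|, abs_nonneg L, fun x y => (hL x y).trans (mul_le_mul_of_nonneg_right (le_abs_self L)
      (Real.rpow_nonneg (apply_nonneg N _) _))⟩
  obtain ⟨L, hL0, hL⟩ : ∃ L : ℝ, 0 ≤ L ∧
      ∀ r s, 0 ≤ r → 0 ≤ s → |K r - K s| ≤ L * |r - s| ^ β := by
    obtain ⟨L, hL⟩ := hKC.holder
    exact ⟨|L|, abs_nonneg L, fun r s hr hs => (hL r s hr hs).trans
      (mul_le_mul_of_nonneg_right (le_abs_self L) (Real.rpow_nonneg (abs_nonneg _) _))⟩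
  have hfc : Continuous f := continuous_of_abs_sub_le_rpow hα hLf
  have hKc : Continuous fun x : Fin d → ℝ => K (N x) :=
    continuous_of_abs_sub_le_rpow hβ (abs_kernel_sub_le hL0 hβ.le hL)
  have hmom := integrable_kernel_mul_rpow hd hN hK hα hαβ hKC.moment
  obtain ⟨B, hB0, hB⟩ := exists_kernel_mul_rpow_le hd hK hβ.le hKC.moment
  have hfar : ∀ x, r₀ < N x → f x = 0 := fun x hx => density_eq_zero_of_far hf hfc hdens hsupp hx
  obtain ⟨Bn, hBn, hnet⟩ := exists_net hN (show 0 ≤ r₀ + 1 by linarith)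
  -- Stationarity carries the support of `X 1` over to each of the countably many variables.
  have hbdd : ∀ᵐ ω ∂μ, ∀ i, 1 ≤ i → N (X i ω) ≤ r₀ := by
    refine ae_all_iff.2 fun i => Filter.eventually_imp_distrib_left.2 fun hi => ?_
    have hms : MeasurableSet {x : Fin d → ℝ | r₀ < N x} :=
      (isOpen_lt continuous_const (continuous_seminorm N)).measurableSet
    have hms' : MeasurableSet {x : S | r₀ < N x} := measurable_subtype_coe hms
    have h1 : μ.map (X i) {x : S | r₀ < N x} = 0 := by
      rw [hstat.map_eq hX hi, Measure.map_apply (hX 1 le_rfl) hms']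
      rwa [Measure.map_apply (f := fun ω => (X 1 ω : Fin d → ℝ))
        (measurable_subtype_coe.comp (hX 1 le_rfl)) hms] at hsupp
    rw [Measure.map_apply (hX i hi) hms'] at h1
    filter_upwards [measure_eq_zero_iff_ae_notMem.1 h1] with ω hω
    exact not_lt.1 hω
  set q := 1 + (d + α) / β with hq
  have hq0 : 0 ≤ q := by positivity
  set D := q * d + 3 with hD
  have hD0 : 0 ≤ D := by positivity
  -- Chosen so that `(E - M) / K 0 = 4 * D` turns the guaranteed `log n / 4` into the exponent `D *
  -- log n` required by the union bound.
  set E := M + 4 * K 0 * D with hE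
  have hE0 : 0 ≤ E := by positivity
  set c₁ := L + E + Lf * (∫ u, K (N u) * N u ^ α) + Lf + B with hc₁
  have hc₁0 : 0 ≤ c₁ := by
    have hI : 0 ≤ ∫ u, K (N u) * N u ^ α := integral_nonneg fun u =>
      mul_nonneg (hK.nonneg _ (apply_nonneg N u)) (Real.rpow_nonneg (apply_nonneg N u) _)
    positivity
  -- the bound for large sample sizes
  have hlarge : ∀ᶠ n : ℕ in Filter.atTop,
      threshold d K φ c₀ b γ (bandwidth d α γ n) ≤ n →
      1 - 1 / (n : ℝ) ≤ μ.real {ω | ∀ x,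
        |kde N K X n (bandwidth d α γ n) ω x - f x| ≤ c₁ * bandwidth d α γ n ^ α} := by
    filter_upwards [eventually_mul_log_rpow_le ((2 + γ) / γ) 1,
      eventually_mul_log_rpow_le (2 / γ) 2, eventually_le_log 1, eventually_le_log ((d + 3) / b),
      (tendsto_natCast_atTop_atTop (R := ℝ)).eventually_ge_atTop (Real.exp 2 * (c₀ + 1)),
      (tendsto_natCast_atTop_atTop (R := ℝ)).eventually_ge_atTop (Bn ^ d * (2 * Real.exp 1))]
      with n hn1 hn2 hlog hlogb hn3 hn4 hthr
    have hn := two_le_of_threshold_le hb hthr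
    have hn0 : (0 : ℝ) < n := by exact_mod_cast (by omega : 0 < n)
    set h := bandwidth d α γ n with hh
    have hh0 : 0 < h := bandwidth_pos hn
    have hh1 : h ≤ 1 := bandwidth_le_one hα (by rw [logRate, div_le_one hn0]; linarith)
    have hhn : (n : ℝ)⁻¹ ≤ h := inv_le_bandwidth hd hα hγ hn hlog
    set k := blockStep γ n with hk
    have hk1 : 1 ≤ k := one_le_blockStep hlog
    have hkn' : (k : ℝ) ≤ n := (blockStep_le hγ hlog).trans hn2
    have hkn : k ≤ n := by exact_mod_cast hkn'
    obtain ⟨T, hT, hTcard⟩ := hnet (h ^ q) (Real.rpow_pos_of_pos hh0 q)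
      (Real.rpow_le_one hh0.le hh1 hq0)
    have hpt : ∀ y ∈ T, μ.real {ω | E * h ^ α ≤
        |kde N K X n h ω y - ∫ u, K (N u) * f (y - h • u)|} ≤
        2 * (k * Real.exp (1 - n * h ^ (2 * α + d) / (2 * k) * ((E - M) / K 0))) := fun y _ =>
      measure_abs_kde_sub_ge_le hC hp hK hKC hKc hX hstat hk1 hkn (by positivity)
        (hmix.imp (fun H => H k hk1) (fun H => H k hk1)) hf hfc.measurable hM hdens hh0 hh1 hα
        (by rw [hE]; linarith [show 0 ≤ 4 * K 0 * D by positivity])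
        (mixing_error_le_one hc₀ hb hγ hK0 hh0 hh1 (hKC.φ_pos h hh0) hthr hlog hlogb hn3) y
    set bad := ⋃ y ∈ T, {ω | E * h ^ α ≤
        |kde N K X n h ω y - ∫ u, K (N u) * f (y - h • u)|} with hbad
    have hbadm : μ.real bad ≤ 1 / n := by
      refine (measureReal_biUnion_finset_le _ _).trans ((Finset.sum_le_sum hpt).trans ?_)
      rw [Finset.sum_const, nsmul_eq_mul]
      refine le_trans (mul_le_mul_of_nonneg_right hTcard (by positivity)) ?_
      refine net_card_mul_exp_le hBn hq0 (by omega) hhn (Nat.cast_nonneg k) hkn' ?_ hn4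
      have h1 := log_le_mul_bandwidth_rpow_div (d := d) hα hγ hn hlog
      have h2 : (E - M) / K 0 = 4 * D := by rw [hE]; field_simp; ring
      rw [h2]
      have := mul_le_mul_of_nonneg_right h1 (show 0 ≤ 4 * D by positivity)
      linarith
    set null := {ω | ¬ ∀ i, 1 ≤ i → N (X i ω) ≤ r₀} with hnull
    have hnullm : μ.real null = 0 := by
      rw [measureReal_def, ae_iff.1 hbdd, ENNReal.toReal_zero]
    -- Covering the whole space uses only subadditivity, so the good event, an intersection over
    -- uncountably many `x`, need not be shown measurable.
    have hcover : (univ : Set Ω) ⊆ {ω | ∀ x, |kde N K X n h ω x - f x| ≤ c₁ * h ^ α} ∪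
        (bad ∪ null) := by
      intro ω _
      by_cases h1 : ω ∈ bad ∪ null
      · exact Or.inr h1
      · left
        rw [mem_union, not_or] at h1
        have h2 : ∀ i, 1 ≤ i → N (X i ω) ≤ r₀ := not_not.1 h1.2
        have h3 : ∀ y ∈ T, |kde N K X n h ω y - ∫ u, K (N u) * f (y - h • u)| ≤ E * h ^ α := by
          intro y hy
          by_contra hlt
          exact h1.1 (mem_biUnion hy (le_of_not_ge hlt))
        exact abs_kde_sub_density_le hK hα hαβ hL0 hLf0 hE0 hL hB0 hB hmom hf hM hLf hfar
          (by omega) hh0 hh1 (fun i hi => h2 i (Finset.mem_Icc.1 hi).1) hT h3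
    have h1 := (measureReal_mono (μ := μ) hcover).trans
      ((measureReal_union_le _ _).trans (add_le_add le_rfl (measureReal_union_le _ _)))
    rw [probReal_univ] at h1
    linarith
  obtain ⟨n₁, hn₁⟩ := Filter.eventually_atTop.1 hlarge
  -- For `n < n₁` the trivial bound `K 0 / h ^ d + M` holds surely; `s n` is the constant it
  -- requires, and the sum over `n < n₁` dominates them all.
  set s : ℕ → ℝ := fun n => (K 0 / bandwidth d α γ n ^ d + M) / bandwidth d α γ n ^ α with hs
  have hs0 : ∀ n, 0 ≤ s n := fun n => by
    have := bandwidth_nonneg d n α γ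
    positivity
  have hsum0 : 0 ≤ ∑ n ∈ Finset.range n₁, s n := Finset.sum_nonneg fun n _ => hs0 n
  refine ⟨c₁ + ∑ n ∈ Finset.range n₁, s n + 1, by linarith, fun n hthr => ?_⟩
  have hn := two_le_of_threshold_le hb hthr
  have hh0 : 0 < bandwidth d α γ n := bandwidth_pos hn
  have hhα : 0 < bandwidth d α γ n ^ α := Real.rpow_pos_of_pos hh0 α
  rw [← bandwidth_rpow_alpha]
  set h := bandwidth d α γ n with hh
  have himp : ∀ c', c' ≤ c₁ + ∑ n ∈ Finset.range n₁, s n + 1 →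
      {ω | ∀ x, |kde N K X n h ω x - f x| ≤ c' * h ^ α} ⊆
      {ω | supNorm (fun x => kde N K X n h ω x - f x) ≤
        ENNReal.ofReal ((c₁ + ∑ n ∈ Finset.range n₁, s n + 1) * h ^ α)} := fun c' hc' ω hω =>
    iSup_le fun x => ENNReal.ofReal_le_ofReal
      ((hω x).trans (mul_le_mul_of_nonneg_right hc' hhα.le))
  rcases le_or_gt n₁ n with hle | hlt
  · exact (hn₁ n hle hthr).trans (measureReal_mono (himp c₁ (by linarith)))
  · have h1 : s n ≤ ∑ n ∈ Finset.range n₁, s n :=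
      Finset.single_le_sum (fun i _ => hs0 i) (Finset.mem_range.2 hlt)
    have h2 : {ω | ∀ x, |kde N K X n h ω x - f x| ≤ s n * h ^ α} = univ := by
      refine eq_univ_of_forall fun ω x => ?_
      have h3 : |kde N K X n h ω x| ≤ K 0 / h ^ d := by
        refine abs_kde_le (by omega) hh0 fun i _ => ?_
        have hnn : 0 ≤ N (x - X i ω) / h := div_nonneg (apply_nonneg N _) hh0.le
        rw [abs_of_nonneg (hK.nonneg _ hnn), mul_div_cancel₀ _ (by positivity)]
        exact hK.le_zero hnn
      have h4 : s n * h ^ α = K 0 / h ^ d + M := div_mul_cancel₀ _ hhα.ne'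
      rw [h4]
      refine (abs_sub _ _).trans (add_le_add h3 ?_)
      rw [abs_of_nonneg (hf x)]
      exact hM x
    have h5 := measureReal_mono (μ := μ) (himp (s n) (by linarith))
    rw [h2, probReal_univ] at h5
    have : 0 ≤ 1 / (n : ℝ) := by positivity
    linarith
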